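/- Write points of $\mathbb R^2\times\mathbb R$ as $(x,\rho,\lambda)$, where $(x,\rho)$ is the state and $\lambda$ is the distinguished parameter. Let $\delta\in\{1,-1\}$, let $\beta\in\mathbb R$ and let $s\ge 2$ be an integer. Let $F=(F_1,F_2)$ be an $\mathbb R^2$-valued map, $C^\infty$ near the origin, of the form $$F(x,\rho,\lambda)=\Big(\lambda x+2\rho^2+\delta x^2+\beta x^{s+1}+\text{h.o.t.},\ \tfrac12\lambda\rho-\delta x\rho+\tfrac12\beta x^s\rho+\text{h.o.t.}\Big),$$ where "h.o.t." denotes any smooth germ all of whose derivatives of order at most $2$ vanish at the origin. (This is the steady-state map of the amplitude system for $r=1$ with distinguished parameter $\lambda=\nu_2$, the remaining parameters being set to zero.) Two germs $F,G$ at the origin are called contact equivalent if there are smooth germs $S$ (with values in the $2\times2$ matrices), $X$ (with values in $\mathbb R^2$) and $\Lambda$ (a function of $\lambda$ alone, with values in $\mathbb R$) such that, near the origin, $$F(x,\rho,\lambda)=S(x,\rho,\lambda)\,G\big(X(x,\rho,\lambda),\Lambda(\lambda)\big),$$ with $X(0)=0$, $\Lambda(0)=0$, $\Lambda'(0)>0$,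 $\det S(0)>0$ and $\det d_{(x,\rho)}X(0)>0$. Then $F$ is $2$-determined with respect to contact equivalence: every smooth germ $G$ with the same $2$-jet at the origin as $F$ (Taylor expansion up to degree $2$ in $(x,\rho,\lambda)$) is contact equivalent to $F$. Moreover, let $\mathcal E$ be the ring of smooth scalar germs at the origin in $(x,\rho,\lambda)$ and $\mathcal M=\langle x,\rho,\lambda\rangle$ its maximal ideal. Let $\mathcal K_s(F)\subseteq\mathcal E^2$ be the restricted tangent space, that is, the $\mathcal E$-submodule generated by $\mathcal M^2\,\partial_xF$, $\mathcal M^2\,\partial_\rho F$, $\mathcal M\,(F_1,0)$, $\mathcal M\,(F_2,0)$, $\mathcal M\,(0,F_1)$ and $\mathcal M\,(0,F_2)$. Then $$\mathcal M^3\,(1,0)+\mathcal M^3\,(0,1)\subseteq\mathcal K_s(F).$$ -/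

import Mathlib

open Filter Topology
open scoped ContDiff

noncomputable section

namespace BifurcationGerm

/-- Points `((x, ρ), lam)`: the state `(x, ρ)` and the distinguished parameter `lam`. -/
abbrev Pt : Type := (ℝ × ℝ) × ℝ

/-- `f` represents a smooth germ at `p`: it is `C^∞` on a neighbourhood of `p`
(`ContDiffAt ℝ ∞ f p` alone would allow the neighbourhood to shrink with the order). -/
def IsSmoothNear {V W : Type*} [NormedAddCommGroup V] [NormedSpace ℝ V]
    [NormedAddCommGroup W] [NormedSpace ℝ W] (f : V → W) (p : V) : Prop :=
  ∀ᶠ z in 𝓝 p, ContDiffAt ℝ ∞ f z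

/-- `F` and `G` have the same `k`-jet (Taylor expansion up to degree `k`) at the origin. -/
def SameJet (k : ℕ) (F G : Pt → ℝ × ℝ) : Prop :=
  ∀ i : ℕ, i ≤ k → iteratedFDeriv ℝ i F 0 = iteratedFDeriv ℝ i G 0

/-- Contact equivalence of the bifurcation problems `F = 0` and `G = 0` (with trivial symmetry
group): `F(u, lam) = S(u, lam) G(X(u, lam), Λ(lam))` near the origin, with smooth germs `S`, `X`,
`Λ` such that `X(0, 0) = 0`, `Λ(0) = 0`, `Λ'(0) > 0`, and such that `S(0, 0)` and `d_u X(0, 0)` lie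
in the identity component of `GL(2, ℝ)`, that is, have positive determinant. -/
def ContactEquivalent (F G : Pt → ℝ × ℝ) : Prop :=
  ∃ (S : Pt → ((ℝ × ℝ) →L[ℝ] (ℝ × ℝ))) (X : Pt → ℝ × ℝ) (Λ : ℝ → ℝ),
    IsSmoothNear S 0 ∧ IsSmoothNear X 0 ∧ IsSmoothNear Λ 0 ∧
    X 0 = 0 ∧ Λ 0 = 0 ∧ 0 < deriv Λ 0 ∧
    0 < (S 0).det ∧ 0 < (fderiv ℝ (fun u : ℝ × ℝ => X (u, 0)) 0).det ∧
    ∀ᶠ z in 𝓝 (0 : Pt), F z = S z (G (X z, Λ z.2))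

/-- `F` is `k`-determined: each smooth germ with the same `k`-jet is contact equivalent to `F`. -/
def IsDetermined (k : ℕ) (F : Pt → ℝ × ℝ) : Prop :=
  ∀ G : Pt → ℝ × ℝ, IsSmoothNear G 0 → SameJet k F G → ContactEquivalent F G

/-- The ring of smooth scalar germs at the origin in the variables `(x, ρ, lam)`. -/
def SmoothGerm : Subring ((𝓝 (0 : Pt)).Germ ℝ) where
  carrier := {g | ∃ f : Pt → ℝ, IsSmoothNear f 0 ∧ (f : (𝓝 (0 : Pt)).Germ ℝ) = g}
  mul_mem' := by
    rintro _ _ ⟨f, hf, rfl⟩ ⟨g, hg, rfl⟩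
    refine ⟨f * g, ?_, rfl⟩
    filter_upwards [hf, hg] with z h1 h2 using h1.mul h2
  one_mem' := ⟨1, Eventually.of_forall fun _ => contDiffAt_const, rfl⟩
  add_mem' := by
    rintro _ _ ⟨f, hf, rfl⟩ ⟨g, hg, rfl⟩
    refine ⟨f + g, ?_, rfl⟩
    filter_upwards [hf, hg] with z h1 h2 using h1.add h2
  zero_mem' := ⟨0, Eventually.of_forall fun _ => contDiffAt_const, rfl⟩
  neg_mem' := by
    rintro _ ⟨f, hf, rfl⟩
    refine ⟨-f, ?_, rfl⟩
    filter_upwards [hf] with z h1 using h1.neg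

/-- The germ at the origin of a function that is smooth near the origin. -/
def toGerm (f : Pt → ℝ) (hf : IsSmoothNear f 0) : SmoothGerm :=
  ⟨(f : (𝓝 (0 : Pt)).Germ ℝ), f, hf, rfl⟩

theorem IsSmoothNear.fst_comp {F : Pt → ℝ × ℝ} (hF : IsSmoothNear F 0) :
    IsSmoothNear (fun z => (F z).1) 0 := by
  filter_upwards [hF] with z h using contDiff_fst.contDiffAt.comp z h

theorem IsSmoothNear.snd_comp {F : Pt → ℝ × ℝ} (hF : IsSmoothNear F 0) :
    IsSmoothNear (fun z => (F z).2) 0 := by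
  filter_upwards [hF] with z h using contDiff_snd.contDiffAt.comp z h

theorem IsSmoothNear.dirDeriv {f : Pt → ℝ} (hf : IsSmoothNear f 0) (v : Pt) :
    IsSmoothNear (fun z => fderiv ℝ f z v) 0 := by
  filter_upwards [hf] with z h
  exact (h.fderiv_right (m := ∞) (by simp)).clm_apply contDiffAt_const

/-- The first component `F₁` of `F`, as a germ. -/
def comp₁ (F : Pt → ℝ × ℝ) (hF : IsSmoothNear F 0) : SmoothGerm :=
  toGerm (fun z => (F z).1) hF.fst_comp

/-- The second component `F₂` of `F`, as a germ. -/
def comp₂ (F : Pt → ℝ × ℝ) (hF : IsSmoothNear F 0) : SmoothGerm :=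
  toGerm (fun z => (F z).2) hF.snd_comp

/-- The pair of germs `(∂_v F₁, ∂_v F₂)` of derivatives in the constant direction `v`. -/
def dirD (F : Pt → ℝ × ℝ) (hF : IsSmoothNear F 0) (v : Pt) : SmoothGerm × SmoothGerm :=
  (toGerm (fun z => fderiv ℝ (fun w => (F w).1) z v) (hF.fst_comp.dirDeriv v),
   toGerm (fun z => fderiv ℝ (fun w => (F w).2) z v) (hF.snd_comp.dirDeriv v))

/-- The germ of the coordinate `x`. -/
def xGerm : SmoothGerm := toGerm (fun z => z.1.1)
  (Eventually.of_forall fun _ => (contDiff_fst.comp contDiff_fst).contDiffAt)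

/-- The germ of the coordinate `ρ`. -/
def rhoGerm : SmoothGerm := toGerm (fun z => z.1.2)
  (Eventually.of_forall fun _ => (contDiff_snd.comp contDiff_fst).contDiffAt)

/-- The germ of the coordinate `lam`. -/
def lamGerm : SmoothGerm := toGerm (fun z => z.2)
  (Eventually.of_forall fun _ => contDiff_snd.contDiffAt)

/-- The maximal ideal `⟨x, ρ, lam⟩` of the ring of smooth germs. -/
def maxIdeal : Ideal SmoothGerm := Ideal.span {xGerm, rhoGerm, lamGerm}

/-- The submodule `𝓜^k (1, 0) + 𝓜^k (0, 1)` of the free module of pairs of germs. -/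
def maxIdealVec (k : ℕ) : Submodule SmoothGerm (SmoothGerm × SmoothGerm) :=
  maxIdeal ^ k • Submodule.span SmoothGerm {(1, 0), (0, 1)}

/-- The restricted tangent space `K_s(F)`, the module generated by `𝓜² F_x`, `𝓜² F_ρ`,
`𝓜 (F₁, 0)`, `𝓜 (F₂, 0)`, `𝓜 (0, F₁)` and `𝓜 (0, F₂)`. -/
def restrictedTangent (F : Pt → ℝ × ℝ) (hF : IsSmoothNear F 0) :
    Submodule SmoothGerm (SmoothGerm × SmoothGerm) :=
  maxIdeal ^ 2 • Submodule.span SmoothGerm {dirD F hF ((1, 0), 0), dirD F hF ((0, 1), 0)} ⊔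
  maxIdeal • Submodule.span SmoothGerm
    {(comp₁ F hF, 0), (comp₂ F hF, 0), (0, comp₁ F hF), (0, comp₂ F hF)}

end BifurcationGerm

end

/-! Since `1 < s`, the terms carrying `β` have degree at least 3, so modulo `𝓜³` only the quadratic
part `Q` (`quadPart`) matters. The algebraic core is `inQuadTangent_cubicForm`: every pair of cubic
forms equals `dQ·ξ + b·Q`, with `ξ` a pair of quadratic forms, `b` a matrix of linear forms and `dQ`
the Jacobian in the state variables. Both conclusions follow from this, neither from the other.

Determinacy is proved without a homotopy. With `X = id + ξ`, `S = 1 + b`, `Λ = id`, the pair `ξ`,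
`b` is taken to represent a cubic form whose coefficients `c` are unknown functions. The defect
`S·G(X) - F` is then a cubic form in the coordinates with coefficients `c + e(z) + r(z, c)`: here
`e` comes from `G - F`, and `r` vanishes at `z = 0` because every remaining error has order 4. Hence
the derivative of the equation in `c` is the identity at the origin, and
`exists_isSmoothNear_implicit` solves it (`contactEquivalent_of_quadPart`).

For the tangent space, replacing `Q` by `F` in the same identity costs an error in `𝓜⁴`, so the
cubic monomial pairs span a module `N` with `N ≤ K_s(F) + 𝓜 N`; Nakayama's lemma gives `N ≤ K_s(F)`.
Hadamard's lemma translates vanishing jets into powers of the ideal. -/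

namespace BifurcationGerm

/-! ### Closure properties of smooth germs. -/

section Smooth

variable {V W Y : Type*} [NormedAddCommGroup V] [NormedSpace ℝ V]
  [NormedAddCommGroup W] [NormedSpace ℝ W] [NormedAddCommGroup Y] [NormedSpace ℝ Y] {p : V}

theorem _root_.ContDiff.isSmoothNear {f : V → W} (hf : ContDiff ℝ ∞ f) (p : V) :
    IsSmoothNear f p :=
  Eventually.of_forall fun _ => hf.contDiffAt

theorem IsSmoothNear.contDiffAt {f : V → W} (hf : IsSmoothNear f p) : ContDiffAt ℝ ∞ f p :=
  hf.self_of_nhds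

theorem IsSmoothNear.continuousAt {f : V → W} (hf : IsSmoothNear f p) : ContinuousAt f p :=
  hf.contDiffAt.continuousAt

theorem IsSmoothNear.congr {f g : V → W} (hf : IsSmoothNear f p) (h : g =ᶠ[𝓝 p] f) :
    IsSmoothNear g p := by
  filter_upwards [hf, h.eventuallyEq_nhds] with z h1 h2 using h1.congr_of_eventuallyEq h2

theorem IsSmoothNear.comp {g : W → Y} {f : V → W} (hg : IsSmoothNear g (f p))
    (hf : IsSmoothNear f p) : IsSmoothNear (fun v => g (f v)) p := by
  filter_upwards [hf, hf.continuousAt.eventually hg] with z h1 h2 using h2.comp z h1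

theorem IsSmoothNear.comp_of_eq {g : W → Y} {f : V → W} {q : W} (hg : IsSmoothNear g q)
    (hf : IsSmoothNear f p) (h : f p = q) : IsSmoothNear (fun v => g (f v)) p := by
  subst h; exact hg.comp hf

theorem IsSmoothNear.prodMk {f : V → W} {g : V → Y} (hf : IsSmoothNear f p)
    (hg : IsSmoothNear g p) : IsSmoothNear (fun v => (f v, g v)) p := by
  filter_upwards [hf, hg] with z h1 h2 using h1.prodMk h2

theorem IsSmoothNear.add {f g : V → W} (hf : IsSmoothNear f p) (hg : IsSmoothNear g p) :
    IsSmoothNear (fun v => f v + g v) p := by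
  filter_upwards [hf, hg] with z h1 h2 using h1.add h2

theorem IsSmoothNear.sub {f g : V → W} (hf : IsSmoothNear f p) (hg : IsSmoothNear g p) :
    IsSmoothNear (fun v => f v - g v) p := by
  filter_upwards [hf, hg] with z h1 h2 using h1.sub h2

theorem IsSmoothNear.smul {f : V → ℝ} {g : V → W} (hf : IsSmoothNear f p)
    (hg : IsSmoothNear g p) : IsSmoothNear (fun v => f v • g v) p := by
  filter_upwards [hf, hg] with z h1 h2 using h1.smul h2

theorem IsSmoothNear.mul {f g : V → ℝ} (hf : IsSmoothNear f p)
    (hg : IsSmoothNear g p) : IsSmoothNear (fun v => f v * g v) p := hf.smul hg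

theorem IsSmoothNear.sum {ι : Type*} {s : Finset ι} {f : ι → V → W}
    (hf : ∀ i ∈ s, IsSmoothNear (f i) p) : IsSmoothNear (fun v => ∑ i ∈ s, f i v) p := by
  have : ∀ᶠ z in 𝓝 p, ∀ i ∈ s, ContDiffAt ℝ ∞ (f i) z :=
    (Filter.eventually_all_finset s).2 hf
  filter_upwards [this] with z h using ContDiffAt.sum h

theorem IsSmoothNear.pi {ι : Type*} [Fintype ι] {f : V → ι → W}
    (hf : ∀ i, IsSmoothNear (fun v => f v i) p) : IsSmoothNear f p := by
  have : ∀ᶠ z in 𝓝 p, ∀ i, ContDiffAt ℝ ∞ (fun v => f v i) z := Filter.eventually_all.2 hf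
  filter_upwards [this] with z h using contDiffAt_pi.2 h

theorem isSmoothNear_const (c : W) : IsSmoothNear (fun _ : V => c) p :=
  contDiff_const.isSmoothNear p

end Smooth

/-! ### Powers of the ideal generated by three functions, at a point of an arbitrary normed space.
-/

section Order

variable {V V' : Type*} [NormedAddCommGroup V] [NormedSpace ℝ V]
  [NormedAddCommGroup V'] [NormedSpace ℝ V']
  {co : Fin 3 → V → ℝ} {co' : Fin 3 → V' → ℝ} {p : V} {p' : V'}

/-- The germ of `f` at `p` lies in the `n`-th power of the ideal generated by the functions `co`
in the ring of smooth germs at `p`. -/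
def VanishesToOrder (co : Fin 3 → V → ℝ) (p : V) : ℕ → (V → ℝ) → Prop
  | 0, f => IsSmoothNear f p
  | n + 1, f => ∃ g : Fin 3 → V → ℝ, (∀ i, VanishesToOrder co p n (g i)) ∧
      f =ᶠ[𝓝 p] fun v => ∑ i, co i v * g i v

namespace VanishesToOrder

theorem congr {n : ℕ} {f g : V → ℝ} (hf : VanishesToOrder co p n f) (h : g =ᶠ[𝓝 p] f) :
    VanishesToOrder co p n g := by
  cases n with
  | zero => exact IsSmoothNear.congr hf h
  | succ n => obtain ⟨k, hk, e⟩ := hf; exact ⟨k, hk, h.trans e⟩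

theorem add {n : ℕ} {f g : V → ℝ} (hf : VanishesToOrder co p n f)
    (hg : VanishesToOrder co p n g) : VanishesToOrder co p n (fun v => f v + g v) := by
  induction n generalizing f g with
  | zero => exact IsSmoothNear.add hf hg
  | succ n ih =>
    obtain ⟨a, ha, ea⟩ := hf
    obtain ⟨b, hb, eb⟩ := hg
    refine ⟨fun i v => a i v + b i v, fun i => ih (ha i) (hb i), ?_⟩
    filter_upwards [ea, eb] with v h1 h2
    rw [h1, h2, ← Finset.sum_add_distrib]
    simp only [mul_add]

theorem smooth_mul {n : ℕ} {f g : V → ℝ} (hf : IsSmoothNear f p)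
    (hg : VanishesToOrder co p n g) : VanishesToOrder co p n (fun v => f v * g v) := by
  induction n generalizing g with
  | zero => exact IsSmoothNear.mul hf hg
  | succ n ih =>
    obtain ⟨b, hb, eb⟩ := hg
    refine ⟨fun i v => f v * b i v, fun i => ih (hb i), ?_⟩
    filter_upwards [eb] with v h2
    rw [h2, Finset.mul_sum]
    exact Finset.sum_congr rfl fun i _ => by ring

theorem const_mul {n : ℕ} (c : ℝ) {g : V → ℝ}
    (hg : VanishesToOrder co p n g) : VanishesToOrder co p n (fun v => c * g v) :=
  smooth_mul (isSmoothNear_const c) hg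

theorem sub {n : ℕ} {f g : V → ℝ} (hf : VanishesToOrder co p n f)
    (hg : VanishesToOrder co p n g) : VanishesToOrder co p n (fun v => f v - g v) :=
  (hf.add (hg.const_mul (-1))).congr (Eventually.of_forall fun v => by ring)

theorem zero (n : ℕ) : VanishesToOrder co p n (fun _ => 0) := by
  induction n with
  | zero => exact isSmoothNear_const 0
  | succ n ih => exact ⟨fun _ _ => 0, fun _ => ih, Eventually.of_forall fun v => by simp⟩

theorem sum {ι : Type*} {s : Finset ι} {n : ℕ} {f : ι → V → ℝ}
    (hf : ∀ i ∈ s, VanishesToOrder co p n (f i)) :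
    VanishesToOrder co p n (fun v => ∑ i ∈ s, f i v) := by
  classical
  induction s using Finset.induction_on with
  | empty => simpa using zero n
  | insert a s ha ih =>
    simp only [Finset.sum_insert ha]
    exact (hf a (by simp)).add (ih fun i hi => hf i (by simp [hi]))

theorem coord_mul {n : ℕ} {f : V → ℝ} (hf : VanishesToOrder co p n f) (i : Fin 3) :
    VanishesToOrder co p (n + 1) (fun v => co i v * f v) := by
  refine ⟨fun j v => (if j = i then 1 else 0) * f v, fun j => hf.const_mul _,
    Eventually.of_forall fun v => ?_⟩
  simp

theorem coord_self (i : Fin 3) : VanishesToOrder co p 1 (co i) := by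
  simpa using coord_mul (n := 0) (isSmoothNear_const (p := p) (1 : ℝ)) i

theorem mul {m n : ℕ} {f g : V → ℝ} (hf : VanishesToOrder co p m f)
    (hg : VanishesToOrder co p n g) : VanishesToOrder co p (m + n) (fun v => f v * g v) := by
  induction m generalizing f with
  | zero => rw [zero_add]; exact smooth_mul hf hg
  | succ m ih =>
    obtain ⟨a, ha, ea⟩ := hf
    rw [Nat.succ_add]
    refine ⟨fun i v => a i v * g v, fun i => ih (ha i), ?_⟩
    filter_upwards [ea] with v h1
    rw [h1, Finset.sum_mul]
    exact Finset.sum_congr rfl fun i _ => by ring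

theorem isSmoothNear (hco : ∀ i, IsSmoothNear (co i) p) {n : ℕ} {f : V → ℝ}
    (hf : VanishesToOrder co p n f) : IsSmoothNear f p := by
  induction n generalizing f with
  | zero => exact hf
  | succ n ih =>
    obtain ⟨a, ha, ea⟩ := hf
    exact (IsSmoothNear.sum fun i _ => (hco i).mul (ih (ha i))).congr ea

theorem of_succ (hco : ∀ i, IsSmoothNear (co i) p) {n : ℕ} {f : V → ℝ}
    (hf : VanishesToOrder co p (n + 1) f) : VanishesToOrder co p n f := by
  induction n generalizing f with
  | zero => exact isSmoothNear hco hf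
  | succ n ih =>
    obtain ⟨a, ha, ea⟩ := hf
    exact ⟨a, fun i => ih (ha i), ea⟩

theorem apply_eq_zero (h0 : ∀ i, co i p = 0) {n : ℕ} {f : V → ℝ}
    (hf : VanishesToOrder co p (n + 1) f) : f p = 0 := by
  obtain ⟨a, -, ea⟩ := hf
  rw [ea.self_of_nhds]
  simp [h0]

theorem comp {n : ℕ} {f : V → ℝ} (hf : VanishesToOrder co p n f) {w : V' → V}
    (hw : IsSmoothNear w p') (hp : w p' = p)
    (hc : ∀ i, VanishesToOrder co' p' 1 (fun v => co i (w v))) :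
    VanishesToOrder co' p' n (fun v => f (w v)) := by
  induction n generalizing f with
  | zero => exact IsSmoothNear.comp_of_eq hf hw hp
  | succ n ih =>
    obtain ⟨a, ha, ea⟩ := hf
    have : VanishesToOrder co' p' (n + 1) (fun v => ∑ i, co i (w v) * a i (w v)) := by
      refine sum fun i _ => ?_
      rw [add_comm]
      exact (hc i).mul (ih (ha i))
    refine this.congr ?_
    have ht : Tendsto w (𝓝 p') (𝓝 p) := by simpa [hp] using hw.continuousAt.tendsto
    exact ht.eventually ea

/-- A function vanishing to order `n + 3` is a cubic form with coefficients vanishing to order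
`n`. -/
theorem exists_cubic {n : ℕ} {f : V → ℝ} (hf : VanishesToOrder co p (n + 3) f) :
    ∃ r : Fin 3 → Fin 3 → Fin 3 → V → ℝ, (∀ i j k, VanishesToOrder co p n (r i j k)) ∧
      f =ᶠ[𝓝 p] fun v => ∑ i, ∑ j, ∑ k, co i v * co j v * co k v * r i j k v := by
  obtain ⟨a, ha, ea⟩ := hf
  choose b hb eb using ha
  choose d hd ed using hb
  refine ⟨d, hd, ?_⟩
  have e1 := Filter.eventually_all.2 eb
  have e2 := Filter.eventually_all.2 fun i => Filter.eventually_all.2 fun j => ed i j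
  filter_upwards [ea, e1, e2] with v h0 h1 h2
  rw [h0]
  refine Finset.sum_congr rfl fun i _ => ?_
  rw [h1 i, Finset.mul_sum]
  refine Finset.sum_congr rfl fun j _ => ?_
  rw [h2 i j, Finset.mul_sum, Finset.mul_sum]
  exact Finset.sum_congr rfl fun k _ => by ring

theorem hasFDerivAt_zero (hco : ∀ i, IsSmoothNear (co i) p) (h0 : ∀ i, co i p = 0) {f : V → ℝ}
    (hf : VanishesToOrder co p 2 f) : HasFDerivAt f (0 : V →L[ℝ] ℝ) p := by
  obtain ⟨a, ha, ea⟩ := hf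
  have hd : ∀ {h : V → ℝ}, IsSmoothNear h p → HasFDerivAt h (fderiv ℝ h p) p := fun hh =>
    (hh.contDiffAt.differentiableAt (by simp)).hasFDerivAt
  have hs : HasFDerivAt (fun v => ∑ i, co i v * a i v) (∑ i : Fin 3, (0 : V →L[ℝ] ℝ)) p := by
    refine HasFDerivAt.fun_sum fun i _ => ?_
    have := (hd (hco i)).mul (hd ((ha i).isSmoothNear hco))
    rw [h0 i, (ha i).apply_eq_zero h0] at this
    simp only [zero_smul, add_zero] at this
    exact this
  simpa using hs.congr_of_eventuallyEq ea

/-- By the Leibniz rule one derivative costs one order. This compares the Jacobian of `F` with that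
of its quadratic part. -/
theorem fderiv_apply (hco : ∀ i, IsSmoothNear (co i) p) (e : V)
    {n : ℕ} {f : V → ℝ}
    (hf : VanishesToOrder co p (n + 1) f) :
    VanishesToOrder co p n (fun v => fderiv ℝ f v e) := by
  have hsm : ∀ {h : V → ℝ}, IsSmoothNear h p → IsSmoothNear (fun v => fderiv ℝ h v e) p := by
    intro h hh
    filter_upwards [hh] with z h
    exact (h.fderiv_right (m := ∞) (by simp)).clm_apply contDiffAt_const
  induction n generalizing f with
  | zero => exact hsm (hf.isSmoothNear hco)
  | succ n ih =>
    obtain ⟨a, ha, ea⟩ := hf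
    have key : VanishesToOrder co p (n + 1)
        (fun v => ∑ i, (co i v * fderiv ℝ (a i) v e + fderiv ℝ (co i) v e * a i v)) :=
      sum fun i _ => (coord_mul (ih (ha i)) i).add ((ha i).smooth_mul (hsm (hco i)))
    refine key.congr ?_
    have e1 := Filter.eventually_all.2 hco
    have e2 := Filter.eventually_all.2 fun i => (ha i).isSmoothNear hco
    filter_upwards [ea.eventuallyEq_nhds, e1, e2] with v h0 h1 h2
    rw [h0.fderiv_eq]
    have : HasFDerivAt (fun v => ∑ i, co i v * a i v)
        (∑ i, (co i v • fderiv ℝ (a i) v + a i v • fderiv ℝ (co i) v)) v := by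
      refine HasFDerivAt.fun_sum fun i _ => ?_
      exact ((h1 i).differentiableAt (by simp)).hasFDerivAt.mul
        ((h2 i).differentiableAt (by simp)).hasFDerivAt
    rw [this.fderiv]
    simp only [FunLike.coe_sum, Finset.sum_apply, _root_.add_apply, _root_.smul_apply, smul_eq_mul]
    exact Finset.sum_congr rfl fun i _ => by ring

end VanishesToOrder

end Order

/-! ### Smoothness of averages along rays. -/

section ParametricIntegral

open MeasureTheory Metric Set

variable {V : Type} [NormedAddCommGroup V] [NormedSpace ℝ V] {r : ℝ}

theorem smul_mem_ball_of_mem_uIoc {t ρ : ℝ} (ht : t ∈ uIoc (0 : ℝ) 1) {z : V}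
    (hz : z ∈ ball (0 : V) ρ) : t • z ∈ ball (0 : V) ρ := by
  rw [uIoc_of_le zero_le_one] at ht
  rw [mem_ball_zero_iff] at hz ⊢
  rw [norm_smul, Real.norm_of_nonneg ht.1.le]
  exact (mul_le_of_le_one_left (norm_nonneg z) ht.2).trans_lt hz

theorem continuousOn_pow_smul_comp_smul {W : Type} [NormedAddCommGroup W] [NormedSpace ℝ W]
    {h : V → W} (hh : ContinuousOn h (ball 0 r)) (m : ℕ) {z : V} (hz : z ∈ ball (0 : V) r) :
    ContinuousOn (fun t : ℝ => t ^ m • h (t • z)) (Icc 0 1) := by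
  refine (continuousOn_pow m).smul (hh.comp (by fun_prop) fun t ht => ?_)
  rw [mem_ball_zero_iff] at hz ⊢
  rw [norm_smul, Real.norm_of_nonneg ht.1]
  exact (mul_le_of_le_one_left (norm_nonneg z) ht.2).trans_lt hz

variable [FiniteDimensional ℝ V]

/-- The chain rule brings out a factor `t`, so the weight `t ^ m` makes this family of integrals
closed under differentiation; that drives the induction on the order of smoothness. -/
theorem hasFDerivAt_integral_pow_smul {W : Type} [NormedAddCommGroup W] [NormedSpace ℝ W]
    {h : V → W} (hh : ∀ z ∈ ball (0 : V) r, ContDiffAt ℝ ∞ h z) (m : ℕ) {z : V}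
    (hz : z ∈ ball (0 : V) r) :
    HasFDerivAt (fun z => ∫ t in (0 : ℝ)..1, t ^ m • h (t • z))
      (∫ t in (0 : ℝ)..1, t ^ (m + 1) • fderiv ℝ h (t • z)) z := by
  have hc : ContinuousOn h (ball 0 r) := fun z hz => (hh z hz).continuousAt.continuousWithinAt
  have hd : ContinuousOn (fderiv ℝ h) (ball 0 r) := fun z hz =>
    ((hh z hz).fderiv_right (m := ∞) (by simp)).continuousAt.continuousWithinAt
  obtain ⟨ρ, hzρ, hρr⟩ := exists_between (mem_ball_zero_iff.1 hz)
  have hsub : closedBall (0 : V) ρ ⊆ ball 0 r := closedBall_subset_ball hρr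
  obtain ⟨C, hC⟩ := (isCompact_closedBall (0 : V) ρ).exists_bound_of_continuousOn (hd.mono hsub)
  have hzs : ball (0 : V) ρ ∈ 𝓝 z := isOpen_ball.mem_nhds (mem_ball_zero_iff.2 hzρ)
  have hmeas : ∀ {Y : Type} [NormedAddCommGroup Y] [NormedSpace ℝ Y] {g : V → Y} (k : ℕ),
      ContinuousOn g (ball 0 r) → ∀ w ∈ ball (0 : V) r,
      IntervalIntegrable (fun t : ℝ => t ^ k • g (t • w)) volume 0 1 := by
    intro Y _ _ g k hg w hw
    apply ContinuousOn.intervalIntegrable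
    rw [uIcc_of_le zero_le_one]
    exact continuousOn_pow_smul_comp_smul hg k hw
  refine intervalIntegral.hasFDerivAt_integral_of_dominated_of_fderiv_le (s := ball 0 ρ)
    (F := fun z t => t ^ m • h (t • z)) (F' := fun z t => t ^ (m + 1) • fderiv ℝ h (t • z))
    (bound := fun _ => C) hzs ?_ (hmeas m hc z hz) ?_ ?_ intervalIntegrable_const ?_
  · filter_upwards [isOpen_ball.mem_nhds hz] with w hw
    exact (intervalIntegrable_iff.1 (hmeas m hc w hw)).aestronglyMeasurable
  · exact (intervalIntegrable_iff.1 (hmeas (m + 1) hd z hz)).aestronglyMeasurable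
  · refine Eventually.of_forall fun t ht w hw => ?_
    have hb := hC _ (ball_subset_closedBall (smul_mem_ball_of_mem_uIoc ht hw))
    rw [uIoc_of_le zero_le_one] at ht
    rw [norm_smul, Real.norm_of_nonneg (pow_nonneg ht.1.le _)]
    exact (mul_le_of_le_one_left (norm_nonneg _) (pow_le_one₀ ht.1.le ht.2)).trans hb
  · refine Eventually.of_forall fun t ht w hw => ?_
    have hw' := hsub (ball_subset_closedBall (smul_mem_ball_of_mem_uIoc ht hw))
    have h1 : HasFDerivAt h (fderiv ℝ h (t • w)) (t • w) :=
      ((hh _ hw').differentiableAt (by simp)).hasFDerivAt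
    have h2 : HasFDerivAt (fun w : V => t • w) (t • ContinuousLinearMap.id ℝ V) w :=
      (hasFDerivAt_id w).const_smul t
    have h3 := (h1.comp w h2).const_smul (t ^ m)
    convert! h3 using 1
    ext v
    simp [pow_succ, mul_smul]

theorem contDiffAt_integral_pow_smul (n : ℕ) {W : Type} [NormedAddCommGroup W] [NormedSpace ℝ W]
    {h : V → W} (hh : ∀ z ∈ ball (0 : V) r, ContDiffAt ℝ ∞ h z) (m : ℕ) :
    ∀ z ∈ ball (0 : V) r,
      ContDiffAt ℝ n (fun z => ∫ t in (0 : ℝ)..1, t ^ m • h (t • z)) z := by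
  induction n generalizing W m with
  | zero =>
    intro z hz
    exact contDiffAt_zero.2 ⟨ball 0 r, isOpen_ball.mem_nhds hz, fun w hw =>
      (hasFDerivAt_integral_pow_smul hh m hw).continuousAt.continuousWithinAt⟩
  | succ n ih =>
    intro z hz
    refine contDiffAt_succ_iff_hasFDerivAt.2
      ⟨_, ⟨ball 0 r, isOpen_ball.mem_nhds hz, fun w hw => hasFDerivAt_integral_pow_smul hh m hw⟩,
        ih (h := fderiv ℝ h) (fun w hw => (hh w hw).fderiv_right (m := ∞) (by simp)) (m + 1) z hz⟩

theorem isSmoothNear_integral_pow_smul {W : Type} [NormedAddCommGroup W] [NormedSpace ℝ W]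
    {h : V → W} (hh : IsSmoothNear h 0) (m : ℕ) :
    IsSmoothNear (fun z => ∫ t in (0 : ℝ)..1, t ^ m • h (t • z)) 0 := by
  obtain ⟨r, hr, hb⟩ := Metric.eventually_nhds_iff_ball.1 hh
  filter_upwards [ball_mem_nhds 0 hr] with z hz
  exact contDiffAt_infty.2 fun n => contDiffAt_integral_pow_smul n hb m z hz

end ParametricIntegral

/-! ### Hadamard's lemma. -/

section Hadamard

open Metric Set

/-- The coordinate functions `x`, `ρ`, `lam`. -/
def coord : Fin 3 → Pt → ℝ := ![fun z => z.1.1, fun z => z.1.2, fun z => z.2]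

@[simp] theorem coord_zero_apply (z : Pt) : coord 0 z = z.1.1 := rfl
@[simp] theorem coord_one_apply (z : Pt) : coord 1 z = z.1.2 := rfl
@[simp] theorem coord_two_apply (z : Pt) : coord 2 z = z.2 := rfl

theorem isSmoothNear_coord (i : Fin 3) (p : Pt) : IsSmoothNear (coord i) p := by
  apply ContDiff.isSmoothNear
  fin_cases i
  · exact contDiff_fst.comp contDiff_fst
  · exact contDiff_snd.comp contDiff_fst
  · exact contDiff_snd

theorem coord_smul (i : Fin 3) (t : ℝ) (z : Pt) : coord i (t • z) = t * coord i z := by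
  fin_cases i <;> rfl

theorem coord_origin (i : Fin 3) : coord i 0 = 0 := by
  fin_cases i <;> rfl

/-- The coordinate vectors. -/
def basisVec : Fin 3 → Pt := ![((1, 0), 0), ((0, 1), 0), ((0, 0), 1)]

theorem eq_sum_coord (z : Pt) : z = ∑ i, coord i z • basisVec i := by
  obtain ⟨⟨x, ρ⟩, l⟩ := z
  simp [Fin.sum_univ_three, basisVec]

/-- Coordinates are homogeneous: `coord i (t • z) = t * coord i z`. The coordinate leaves the
integral and `t` joins the weight, so no order is lost. -/
theorem VanishesToOrder.integral_pow_mul {n : ℕ} {h : Pt → ℝ} (hh : VanishesToOrder coord 0 n h)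
    (m : ℕ) :
    VanishesToOrder coord 0 n (fun z => ∫ t in (0 : ℝ)..1, t ^ m * h (t • z)) := by
  induction n generalizing h m with
  | zero => exact isSmoothNear_integral_pow_smul hh m
  | succ n ih =>
    obtain ⟨a, ha, ea⟩ := hh
    refine ⟨_, fun i => ih (ha i) (m + 1), ?_⟩
    have hsm := Filter.eventually_all.2 fun i => (ha i).isSmoothNear fun i => isSmoothNear_coord i 0
    obtain ⟨r, hr, hb⟩ := Metric.eventually_nhds_iff_ball.1 (ea.and hsm)
    filter_upwards [ball_mem_nhds 0 hr] with z hz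
    have hint : ∀ i, IntervalIntegrable (fun t : ℝ => t ^ (m + 1) * a i (t • z))
        MeasureTheory.volume 0 1 := by
      intro i
      apply ContinuousOn.intervalIntegrable
      rw [uIcc_of_le zero_le_one]
      exact continuousOn_pow_smul_comp_smul (fun w hw =>
        ((hb w hw).2 i).continuousAt.continuousWithinAt) (m + 1) hz
    simp_rw [← intervalIntegral.integral_const_mul]
    rw [← intervalIntegral.integral_finsetSum fun i _ => (hint i).const_mul _]
    refine intervalIntegral.integral_congr_ae (Eventually.of_forall fun t ht => ?_)
    rw [(hb _ (smul_mem_ball_of_mem_uIoc ht hz)).1, Finset.mul_sum]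
    refine Finset.sum_congr rfl fun i _ => ?_
    rw [coord_smul]
    ring

/-- Fundamental theorem of calculus along the segment from `0` to `z`. -/
theorem eq_sum_coord_mul_integral {f : Pt → ℝ} (hf : IsSmoothNear f 0) (h0 : f 0 = 0) :
    f =ᶠ[𝓝 0] fun z => ∑ i, coord i z *
      ∫ t in (0 : ℝ)..1, t ^ 0 * fderiv ℝ f (t • z) (basisVec i) := by
  obtain ⟨r, hr, hb⟩ := Metric.eventually_nhds_iff_ball.1 hf
  filter_upwards [ball_mem_nhds 0 hr] with z hz
  have hmem : ∀ t ∈ Icc (0 : ℝ) 1, t • z ∈ ball (0 : Pt) r := by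
    intro t ht
    rw [mem_ball_zero_iff] at hz ⊢
    rw [norm_smul, Real.norm_of_nonneg ht.1]
    exact (mul_le_of_le_one_left (norm_nonneg z) ht.2).trans_lt hz
  have hcont : ∀ v : Pt, ContinuousOn (fun t : ℝ => fderiv ℝ f (t • z) v) (Icc 0 1) := by
    intro v t ht
    have h1 : ContinuousAt (fderiv ℝ f) (t • z) :=
      ((hb _ (hmem t ht)).fderiv_right (m := ∞) (by simp)).continuousAt
    have h2 : ContinuousAt (fun t : ℝ => fderiv ℝ f (t • z)) t :=
      ContinuousAt.comp (f := fun t : ℝ => t • z) h1 (by fun_prop)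
    exact (h2.clm_apply continuousAt_const).continuousWithinAt
  have hint : ∀ v : Pt, IntervalIntegrable (fun t : ℝ => fderiv ℝ f (t • z) v)
      MeasureTheory.volume 0 1 := by
    intro v
    apply ContinuousOn.intervalIntegrable
    rw [uIcc_of_le zero_le_one]
    exact hcont v
  have key : ∫ t in (0 : ℝ)..1, fderiv ℝ f (t • z) z = f ((1 : ℝ) • z) - f ((0 : ℝ) • z) := by
    refine intervalIntegral.integral_eq_sub_of_hasDerivAt (f := fun t : ℝ => f (t • z))
      (fun t ht => ?_) (hint z)
    rw [uIcc_of_le zero_le_one] at ht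
    have h1 : HasFDerivAt f (fderiv ℝ f (t • z)) (t • z) :=
      ((hb _ (hmem t ht)).differentiableAt (by simp)).hasFDerivAt
    have h2 : HasDerivAt (fun t : ℝ => t • z) z t := by
      simpa using (hasDerivAt_id t).smul_const z
    exact h1.comp_hasDerivAt t h2
  rw [one_smul, zero_smul, h0, sub_zero] at key
  rw [← key]
  simp_rw [pow_zero, one_mul, ← intervalIntegral.integral_const_mul]
  rw [← intervalIntegral.integral_finsetSum fun i _ => (hint _).const_mul _]
  congr 1
  ext t
  conv_lhs => rw [eq_sum_coord z]
  rw [map_sum]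
  refine Finset.sum_congr rfl fun i _ => ?_
  rw [map_smul, smul_eq_mul, ← eq_sum_coord z]

/-- **Hadamard's lemma**: a smooth germ whose `k`-jet vanishes lies in the `(k + 1)`-st power of
the ideal of the coordinate functions. -/
theorem vanishesToOrder_of_iteratedFDeriv_eq_zero {k : ℕ} {f : Pt → ℝ} (hf : IsSmoothNear f 0)
    (hk : ∀ i ≤ k, iteratedFDeriv ℝ i f 0 = 0) : VanishesToOrder coord 0 (k + 1) f := by
  induction k generalizing f with
  | zero =>
    have h0 : f 0 = 0 := by simpa using congrArg (fun T => T 0) (hk 0 le_rfl)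
    exact ⟨_, fun i => isSmoothNear_integral_pow_smul (hf.dirDeriv (basisVec i)) 0,
      eq_sum_coord_mul_integral hf h0⟩
  | succ k ih =>
    have h0 : f 0 = 0 := by simpa using congrArg (fun T => T 0) (hk 0 (Nat.zero_le _))
    refine ⟨_, fun i => VanishesToOrder.integral_pow_mul
      (ih (hf.dirDeriv (basisVec i)) fun j hj => ?_) 0,
      eq_sum_coord_mul_integral hf h0⟩
    have hd : ContDiffAt ℝ ∞ (fderiv ℝ f) 0 := hf.contDiffAt.fderiv_right (m := ∞) (by simp)
    have := (ContinuousLinearMap.apply ℝ ℝ (basisVec i)).iteratedFDeriv_comp_left hd (i := j)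
      (by exact_mod_cast le_top)
    refine this.trans ?_
    ext v
    have h1 := congrArg (fun T => T (Fin.snoc v (basisVec i))) (hk (j + 1) (by omega))
    simp only [iteratedFDeriv_succ_apply_right] at h1
    simpa using h1

theorem vanishesToOrder_one_sub_const {f : Pt → ℝ} (hf : IsSmoothNear f 0) :
    VanishesToOrder coord 0 1 (fun z => f z - f 0) :=
  vanishesToOrder_of_iteratedFDeriv_eq_zero (hf.sub (isSmoothNear_const _)) fun i hi => by
    obtain rfl : i = 0 := by omega
    ext v
    simp

end Hadamard

/-! ### A smooth implicit function theorem. -/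

section ImplicitFunction

/-- Implicit function theorem for germs of the form `c + Ψ(z, c) = 0`, with a solution that is
smooth on a neighbourhood. -/
theorem exists_isSmoothNear_implicit {V C : Type*} [NormedAddCommGroup V] [NormedSpace ℝ V]
    [CompleteSpace V] [NormedAddCommGroup C] [NormedSpace ℝ C] [CompleteSpace C]
    {Ψ : V × C → C} {c₀ : C} (hΨ : IsSmoothNear Ψ (0, c₀))
    (h0 : ∀ᶠ c in 𝓝 c₀, Ψ (0, c) = -c₀) :
    ∃ c : V → C, IsSmoothNear c 0 ∧ c 0 = c₀ ∧ ∀ᶠ z in 𝓝 0, c z + Ψ (z, c z) = 0 := by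
  set q : V × C := (0, c₀) with hq
  let Φ : V × C → V × C := fun y => (y.1, y.2 + Ψ y)
  have hΦ : IsSmoothNear Φ q :=
    (contDiff_fst.isSmoothNear q).prodMk ((contDiff_snd.isSmoothNear q).add hΨ)
  have hΦq : Φ q = 0 := by
    simp [Φ, hq, h0.self_of_nhds]
  let A : V × C →L[ℝ] C := fderiv ℝ Ψ q
  have hA : HasFDerivAt Ψ A q := (hΨ.contDiffAt.differentiableAt (by simp)).hasFDerivAt
  -- On the slice `z = 0` the map `Ψ` is constant near `c₀`, so its derivative kills the second
  -- factor. The derivative of `Φ` is therefore unipotent triangular, and changing the sign of `A`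
  -- inverts it.
  have hA2 : ∀ w : C, A (0, w) = 0 := by
    have h1 : HasFDerivAt (fun c : C => ((0 : V), c)) (ContinuousLinearMap.inr ℝ V C) c₀ :=
      hasFDerivAt_prodMk_right 0 c₀
    have h2 : HasFDerivAt (fun c : C => Ψ (0, c)) (A.comp (ContinuousLinearMap.inr ℝ V C)) c₀ :=
      HasFDerivAt.comp (g := Ψ) (f := fun c : C => ((0 : V), c)) c₀ hA h1
    have h3 : HasFDerivAt (fun c : C => Ψ (0, c)) (0 : C →L[ℝ] C) c₀ :=
      (hasFDerivAt_const (-c₀) c₀).congr_of_eventuallyEq h0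
    intro w
    have := congrArg (fun L => L w) (h2.unique h3)
    simpa using this
  have hsplit : ∀ v w, A (v, w) = A (v, 0) := by
    intro v w
    have : ((v, w) : V × C) = (v, 0) + (0, w) := by simp
    rw [this, map_add, hA2, add_zero]
  let e : (V × C) ≃L[ℝ] (V × C) := ContinuousLinearEquiv.equivOfInverse
    ((ContinuousLinearMap.fst ℝ V C).prod (ContinuousLinearMap.snd ℝ V C + A))
    ((ContinuousLinearMap.fst ℝ V C).prod (ContinuousLinearMap.snd ℝ V C - A))
    (fun y => by
      obtain ⟨v, w⟩ := y
      have h := hsplit v (w + A (v, 0))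
      simp [hsplit v w, h])
    (fun y => by
      obtain ⟨v, w⟩ := y
      have h := hsplit v (w - A (v, 0))
      simp [hsplit v w, h])
  have he : HasFDerivAt Φ (e : (V × C) →L[ℝ] (V × C)) q :=
    hasFDerivAt_fst.prodMk (hasFDerivAt_snd.add hA)
  let P := hΦ.contDiffAt.toOpenPartialHomeomorph Φ he (by simp)
  have hPΦ : ∀ y, P y = Φ y := fun _ => rfl
  have hqs : q ∈ P.source := hΦ.contDiffAt.mem_toOpenPartialHomeomorph_source he (by simp)
  have h0t : (0 : V × C) ∈ P.target := by
    rw [← hΦq, ← hPΦ]; exact P.map_source hqs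
  have hs0 : P.symm 0 = q := by
    rw [← hΦq, ← hPΦ]; exact P.left_inv hqs
  have hsc : ContinuousAt P.symm 0 := P.continuousAt_symm h0t
  -- Smoothness of the inverse on a whole neighbourhood, not only at one point, needs an invertible
  -- derivative at all nearby points; invertibility is an open condition.
  have hinv : ∀ᶠ y in 𝓝 q, fderiv ℝ Φ y ∈
      Set.range ((↑) : ((V × C) ≃L[ℝ] (V × C)) → (V × C) →L[ℝ] (V × C)) := by
    have hc : ContinuousAt (fderiv ℝ Φ) q :=
      (hΦ.contDiffAt.fderiv_right (m := ∞) (by simp)).continuousAt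
    refine hc.eventually ?_
    rw [he.fderiv]
    exact ContinuousLinearEquiv.nhds e
  have hsm : IsSmoothNear P.symm 0 := by
    have h1 : ∀ᶠ y in 𝓝 (0 : V × C), y ∈ P.target := P.open_target.mem_nhds h0t
    have h2 : ∀ᶠ y in 𝓝 (0 : V × C), _ ∧ _ :=
      hsc.eventually (by rw [hs0]; exact hinv.and hΦ)
    filter_upwards [h1, h2] with y hy hy2
    obtain ⟨⟨e', he'⟩, hd⟩ := hy2
    refine P.contDiffAt_symm (f₀' := e') hy ?_ hd
    rw [he']
    exact (hd.differentiableAt (by simp)).hasFDerivAt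
  have hι : ContDiff ℝ ∞ (fun z : V => ((z, 0) : V × C)) := contDiff_id.prodMk contDiff_const
  have hcs : IsSmoothNear (fun z : V => P.symm (z, 0)) 0 :=
    hsm.comp_of_eq (hι.isSmoothNear 0) rfl
  refine ⟨fun z => (P.symm (z, 0)).2, (contDiff_snd.isSmoothNear _).comp hcs, ?_, ?_⟩
  · show (P.symm (0 : V × C)).2 = c₀
    rw [hs0]
  · have h1 : ∀ᶠ z in 𝓝 (0 : V), ((z, 0) : V × C) ∈ P.target :=
      hι.continuous.continuousAt.eventually (P.open_target.mem_nhds h0t)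
    filter_upwards [h1] with z hz
    have := P.right_inv hz
    rw [hPΦ] at this
    have e1 : (P.symm (z, 0)).1 = z := congrArg Prod.fst this
    have e2 : (P.symm (z, 0)).2 + Ψ (P.symm (z, 0)) = 0 := congrArg Prod.snd this
    have e3 : P.symm (z, 0) = (z, (P.symm (z, 0)).2) := Prod.ext e1 rfl
    rw [← e3]
    exact e2

end ImplicitFunction

/-! ### Cubic forms in the tangent space of the quadratic part. -/

section TangentSpace

/-- Two substitutions that agree to order 2 change `g` only at one order higher: write the
difference of products `coord i * a i` as (difference) · (value) + (value) · (difference) and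
induct. -/
theorem VanishesToOrder.comp_sub_comp {V : Type*} [NormedAddCommGroup V] [NormedSpace ℝ V]
    {co : Fin 3 → V → ℝ} {p : V} {n : ℕ} {g : Pt → ℝ} (hg : VanishesToOrder coord 0 n g)
    {w w' : V → Pt}
    (hw : IsSmoothNear w p) (hw' : IsSmoothNear w' p) (hp : w p = 0) (hp' : w' p = 0)
    (hc : ∀ i, VanishesToOrder co p 1 (fun v => coord i (w v)))
    (hc' : ∀ i, VanishesToOrder co p 1 (fun v => coord i (w' v)))
    (hd : ∀ i, VanishesToOrder co p 2 (fun v => coord i (w v) - coord i (w' v))) :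
    VanishesToOrder co p (n + 1) (fun v => g (w v) - g (w' v)) := by
  induction n generalizing g with
  | zero =>
    have h1 := vanishesToOrder_one_sub_const hg
    exact ((h1.comp hw hp hc).sub (h1.comp hw' hp' hc')).congr
      (Eventually.of_forall fun v => by ring)
  | succ n ih =>
    obtain ⟨a, ha, ea⟩ := hg
    have key : VanishesToOrder co p (n + 1 + 1) (fun v => ∑ i,
        ((coord i (w v) - coord i (w' v)) * a i (w v) +
          coord i (w' v) * (a i (w v) - a i (w' v)))) := by
      refine VanishesToOrder.sum fun i _ => VanishesToOrder.add ?_ ?_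
      · have := (hd i).mul ((ha i).comp hw hp hc)
        rwa [show 2 + n = n + 1 + 1 by omega] at this
      · have := (hc' i).mul (ih (ha i))
        rwa [show 1 + (n + 1) = n + 1 + 1 by omega] at this
    refine key.congr ?_
    have t : Tendsto w (𝓝 p) (𝓝 0) := by simpa [hp] using hw.continuousAt.tendsto
    have t' : Tendsto w' (𝓝 p) (𝓝 0) := by simpa [hp'] using hw'.continuousAt.tendsto
    filter_upwards [t.eventually ea, t'.eventually ea] with v h1 h2
    rw [h1, h2, ← Finset.sum_sub_distrib]
    exact Finset.sum_congr rfl fun i _ => by ring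

/-- The quadratic part of the amplitude system. -/
noncomputable def quadPart (δ : ℝ) : Fin 2 → Pt → ℝ :=
  ![fun z => z.2 * z.1.1 + 2 * z.1.2 ^ 2 + δ * z.1.1 ^ 2,
    fun z => z.2 * z.1.2 / 2 - δ * z.1.1 * z.1.2]

/-- The Jacobian matrix of `quadPart` with respect to the state variables. -/
noncomputable def quadJac (δ : ℝ) : Fin 2 → Fin 2 → Pt → ℝ :=
  ![![fun z => z.2 + 2 * δ * z.1.1, fun z => 4 * z.1.2],
    ![fun z => -δ * z.1.2, fun z => z.2 / 2 - δ * z.1.1]]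

/-- The quadratic form with the given coefficients. -/
def quadForm (a : Fin 6 → ℝ) (z : Pt) : ℝ :=
  a 0 * z.1.1 ^ 2 + a 1 * (z.1.1 * z.1.2) + a 2 * (z.1.1 * z.2) + a 3 * z.1.2 ^ 2 +
    a 4 * (z.1.2 * z.2) + a 5 * z.2 ^ 2

/-- The linear form with the given coefficients. -/
def linForm (a : Fin 3 → ℝ) (z : Pt) : ℝ := a 0 * z.1.1 + a 1 * z.1.2 + a 2 * z.2

theorem vanishesToOrder_coord_mul_coord (i j : Fin 3) :
    VanishesToOrder coord 0 2 (fun z => coord i z * coord j z) :=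
  VanishesToOrder.coord_mul (VanishesToOrder.coord_self j) i

theorem vanishesToOrder_quadForm (a : Fin 6 → ℝ) : VanishesToOrder coord 0 2 (quadForm a) := by
  have h := vanishesToOrder_coord_mul_coord
  refine (((((((h 0 0).const_mul (a 0)).add ((h 0 1).const_mul (a 1))).add
    ((h 0 2).const_mul (a 2))).add ((h 1 1).const_mul (a 3))).add
    ((h 1 2).const_mul (a 4))).add ((h 2 2).const_mul (a 5))).congr
    (Eventually.of_forall fun z => ?_)
  simp only [quadForm, coord_zero_apply, coord_one_apply, coord_two_apply]
  ring

theorem vanishesToOrder_linForm (a : Fin 3 → ℝ) : VanishesToOrder coord 0 1 (linForm a) :=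
  (((VanishesToOrder.coord_self 0).const_mul (a 0)).add
    ((VanishesToOrder.coord_self 1).const_mul (a 1))).add
    ((VanishesToOrder.coord_self 2).const_mul (a 2))

theorem vanishesToOrder_quadPart (δ : ℝ) (p : Fin 2) :
    VanishesToOrder coord 0 2 (quadPart δ p) := by
  fin_cases p
  · refine (vanishesToOrder_quadForm ![δ, 0, 1, 2, 0, 0]).congr (Eventually.of_forall fun z => ?_)
    simp [quadForm, quadPart]
    ring
  · refine (vanishesToOrder_quadForm ![0, -δ, 0, 0, 1/2, 0]).congr
      (Eventually.of_forall fun z => ?_)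
    simp [quadForm, quadPart]
    ring

/-- The pair `h` is a combination of the columns of the Jacobian matrix of `quadPart δ` with
coefficients in the square of the maximal ideal, and of the pairs `(Q, 0)` and `(0, Q)`, with `Q`
a component of `quadPart δ`, with coefficients in the maximal ideal. -/
def InQuadTangent (δ : ℝ) (h : Fin 2 → Pt → ℝ) : Prop :=
  ∃ (ξ : Fin 2 → Pt → ℝ) (b : Fin 2 → Fin 2 → Pt → ℝ),
    (∀ q, VanishesToOrder coord 0 2 (ξ q)) ∧ (∀ p q, VanishesToOrder coord 0 1 (b p q)) ∧
    ∀ p z, h p z = ∑ q, quadJac δ p q z * ξ q z + ∑ q, b p q z * quadPart δ q z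

/-- The cubic form with the given coefficients. -/
def cubicForm (a : Fin 10 → ℝ) (z : Pt) : ℝ :=
  a 0 * z.1.1 ^ 3 + a 1 * z.1.1 ^ 2 * z.1.2 + a 2 * z.1.1 ^ 2 * z.2 + a 3 * z.1.1 * z.1.2 ^ 2 +
    a 4 * z.1.1 * z.1.2 * z.2 + a 5 * z.1.1 * z.2 ^ 2 + a 6 * z.1.2 ^ 3 +
    a 7 * z.1.2 ^ 2 * z.2 + a 8 * z.1.2 * z.2 ^ 2 + a 9 * z.2 ^ 3

/-- A linear system: 12 coefficients of `ξ` and 12 of `b` against the 20 coefficients of a pair of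
cubic forms. The witnesses are an explicit solution, normalised by having no `x` term in any entry
of `b`; `δ² = 1` removes the denominators in `δ`. -/
theorem inQuadTangent_cubicForm {δ : ℝ} (hδ : δ = 1 ∨ δ = -1) (a b : Fin 10 → ℝ) :
    InQuadTangent δ ![cubicForm a, cubicForm b] := by
  refine ⟨![quadForm ![1/2 * δ * a 0,
        1/3 * δ * a 1 - 1/3 * a 4 - 2/3 * δ * a 8 + 4/3 * b 0 - 2/3 * δ * b 3 + 8/3 * b 5 - 4/3 * b 7 + 32/3 * δ * b 9,
        -1/2 * a 0 + δ * a 2 - a 5 + 2 * δ * a 9,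
        -1/3 * a 0 + 4/3 * δ * a 2 - 4/3 * a 5 + 16/3 * δ * a 9 + 2/3 * b 1 + 4/3 * δ * b 4 - δ * b 6 + 8/3 * b 8,
        -1/6 * a 1 + 1/6 * δ * a 4 + 1/3 * a 8 - 1/3 * δ * b 0 + 2/3 * b 2 - 1/6 * b 3 - 1/3 * δ * b 7 - 8/3 * b 9,
        a 9],
      quadForm ![-δ * b 0,
        -2/3 * δ * a 0 + 2/3 * a 2 - 2/3 * δ * a 5 + 8/3 * a 9 - 2/3 * δ * b 1 + 2/3 * b 4 + 4/3 * δ * b 8,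
        -1/3 * b 0 - 2/3 * δ * b 2 + 2/3 * b 5 + 4/3 * δ * b 9,
        -1/6 * δ * a 1 - 1/3 * a 4 + 1/4 * a 6 - 2/3 * δ * a 8 - 2/3 * b 0 - 2/3 * δ * b 3 + 8/3 * b 5 - 4/3 * b 7 + 32/3 * δ * b 9,
        1/4 * a 0 - 1/2 * δ * a 2 + 1/8 * δ * a 3 + 1/4 * a 7 - 2 * δ * a 9 - δ * b 4 + 1/2 * δ * b 6 - 2 * b 8,
        2 * b 9]],
    ![![linForm ![0,
        1/3 * δ * a 1 + 2/3 * a 4 + 4/3 * δ * a 8 + 4/3 * b 0 + 4/3 * δ * b 3 - 16/3 * b 5 + 8/3 * b 7 - 64/3 * δ * b 9,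
        1/2 * a 0 - δ * a 2 + 2 * a 5 - 4 * δ * a 9],
      linForm ![0,
        -10/3 * a 0 + 16/3 * δ * a 2 - δ * a 3 - 16/3 * a 5 + 64/3 * δ * a 9 - 4/3 * b 1 + 16/3 * δ * b 4 - 2 * δ * b 6 + 32/3 * b 8,
        1/3 * a 1 - 1/3 * δ * a 4 + 4/3 * a 8 + 2/3 * δ * b 0 - 4/3 * b 2 + 1/3 * b 3 + 2/3 * δ * b 7 - 32/3 * b 9]],
    ![linForm ![0,
        -1/6 * δ * a 0 + 2/3 * a 2 - 2/3 * δ * a 5 + 8/3 * a 9 + 1/3 * δ * b 1 + 2/3 * b 4 + 4/3 * δ * b 8,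
        1/6 * b 0 + 1/3 * δ * b 2 + 2/3 * b 5 + 4/3 * δ * b 9],
      linForm ![0,
        -1/6 * δ * a 1 + 2/3 * a 4 - 1/4 * a 6 + 4/3 * δ * a 8 - 2/3 * b 0 + 1/3 * δ * b 3 - 16/3 * b 5 + 8/3 * b 7 - 64/3 * δ * b 9,
        -1/4 * a 0 + 1/2 * δ * a 2 - 1/8 * δ * a 3 - 1/4 * a 7 + 4 * δ * a 9 + δ * b 4 - 1/2 * δ * b 6 + 4 * b 8]]], ?_, ?_, ?_⟩
  · intro q
    fin_cases q <;> exact vanishesToOrder_quadForm _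
  · intro p q
    fin_cases p <;> fin_cases q <;> exact vanishesToOrder_linForm _
  · intro p z
    obtain ⟨⟨x, ρ⟩, l⟩ := z
    fin_cases p
    · simp only [Fin.sum_univ_two, quadJac, quadPart, quadForm, linForm, cubicForm, Fin.zero_eta,
        Matrix.cons_val]
      rcases hδ with rfl | rfl <;> ring
    · simp only [Fin.sum_univ_two, quadJac, quadPart, quadForm, linForm, cubicForm, Fin.mk_one,
        Matrix.cons_val]
      rcases hδ with rfl | rfl <;> ring

theorem exists_cubicForm_eq_coord_mul (i j k : Fin 3) :
    ∃ a : Fin 10 → ℝ, ∀ z, coord i z * coord j z * coord k z = cubicForm a z := by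
  have key : ∀ m : Fin 10, (∀ z, coord i z * coord j z * coord k z =
      cubicForm (Pi.single m 1) z) → ∃ a : Fin 10 → ℝ, ∀ z,
        coord i z * coord j z * coord k z = cubicForm a z := fun m h => ⟨_, h⟩
  -- For each of the 27 triples, the number is the position of its monomial in `cubicForm`.
  fin_cases i <;> fin_cases j <;> fin_cases k <;>
  [apply key 0; apply key 1; apply key 2; apply key 1; apply key 3; apply key 4; apply key 2;
    apply key 4; apply key 5; apply key 1; apply key 3; apply key 4; apply key 3; apply key 6;
    apply key 7; apply key 4; apply key 7; apply key 8; apply key 2; apply key 4; apply key 5;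
    apply key 4; apply key 7; apply key 8; apply key 5; apply key 8; apply key 9] <;>
  · intro z
    simp [cubicForm, -mul_eq_mul_left_iff, -mul_eq_mul_right_iff]
    try ring

theorem inQuadTangent_coord_mul {δ : ℝ} (hδ : δ = 1 ∨ δ = -1) (q : Fin 2) (i j k : Fin 3) :
    InQuadTangent δ fun p z => if p = q then coord i z * coord j z * coord k z else 0 := by
  obtain ⟨a, ha⟩ := exists_cubicForm_eq_coord_mul i j k
  have h0 : ∀ z, cubicForm 0 z = 0 := fun z => by simp [cubicForm]
  simp only [ha]
  fin_cases q
  · convert inQuadTangent_cubicForm hδ a 0 using 3 with p z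
    fin_cases p <;> simp [h0]
  · convert inQuadTangent_cubicForm hδ 0 a using 3 with p z
    fin_cases p <;> simp [h0]

end TangentSpace

/-! ### Contact equivalence of maps with the same quadratic part. -/

section Determinacy

/-- The components of a vector. -/
def comps (w : ℝ × ℝ) : Fin 2 → ℝ := ![w.1, w.2]

theorem IsSmoothNear.comps {V : Type*} [NormedAddCommGroup V] [NormedSpace ℝ V] {p : V}
    {F : V → ℝ × ℝ} (hF : IsSmoothNear F p) (q : Fin 2) :
    IsSmoothNear (fun z => comps (F z) q) p := by
  fin_cases q
  · exact (contDiff_fst.isSmoothNear _).comp hF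
  · exact (contDiff_snd.isSmoothNear _).comp hF

/-- Index set of the coefficients of pairs of cubic forms. -/
abbrev CubicIndex : Type := Fin 2 × Fin 3 × Fin 3 × Fin 3

/-- The solution depends linearly on the cubic form, so its coefficients `y.2` can be kept as extra
variables. Orders are counted in the coordinates of `y.1` alone, which leaves the base point `c₀`
arbitrary. -/
theorem exists_combination {δ : ℝ}
    (hT : ∀ (q : Fin 2) (i j k : Fin 3), InQuadTangent δ fun p z =>
      if p = q then coord i z * coord j z * coord k z else 0) (c₀ : CubicIndex → ℝ) :
    ∃ (ξ : Fin 2 → Pt × (CubicIndex → ℝ) → ℝ) (b : Fin 2 → Fin 2 → Pt × (CubicIndex → ℝ) → ℝ),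
      (∀ q, VanishesToOrder (fun i y => coord i y.1) ((0 : Pt), c₀) 2 (ξ q)) ∧
      (∀ p q, VanishesToOrder (fun i y => coord i y.1) ((0 : Pt), c₀) 1 (b p q)) ∧
      ∀ p y, ∑ q, quadJac δ p q y.1 * ξ q y + ∑ q, b p q y * quadPart δ q y.1 =
        ∑ i, ∑ j, ∑ k, coord i y.1 * coord j y.1 * coord k y.1 * y.2 (p, i, j, k) := by
  choose Ξ B hΞ hB hΞB using fun m : CubicIndex => hT m.1 m.2.1 m.2.2.1 m.2.2.2
  have hfst : IsSmoothNear (fun y : Pt × (CubicIndex → ℝ) => y.1) ((0 : Pt), c₀) :=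
    contDiff_fst.isSmoothNear _
  have hcoef : ∀ m, IsSmoothNear (fun y : Pt × (CubicIndex → ℝ) => y.2 m) ((0 : Pt), c₀) :=
    fun m => ContDiff.isSmoothNear
      ((contDiff_apply ℝ ℝ m).comp (contDiff_snd (𝕜 := ℝ) (E := Pt))) _
  have pull : ∀ {n : ℕ} {f : Pt → ℝ}, VanishesToOrder coord 0 n f →
      VanishesToOrder (fun i (y : Pt × (CubicIndex → ℝ)) => coord i y.1) ((0 : Pt), c₀) n
        (fun y => f y.1) := fun hf => hf.comp hfst rfl
          fun i => VanishesToOrder.coord_self (co := fun i (y : Pt × _) => coord i y.1) i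
  refine ⟨fun q y => ∑ m, y.2 m * Ξ m q y.1, fun p q y => ∑ m, y.2 m * B m p q y.1,
    fun q => VanishesToOrder.sum fun m _ => (pull (hΞ m q)).smooth_mul (hcoef m),
    fun p q => VanishesToOrder.sum fun m _ => (pull (hB m p q)).smooth_mul (hcoef m),
    fun p y => ?_⟩
  have h1 : ∑ m : CubicIndex, y.2 m * (if p = m.1 then
      coord m.2.1 y.1 * coord m.2.2.1 y.1 * coord m.2.2.2 y.1 else 0) =
      ∑ i, ∑ j, ∑ k, coord i y.1 * coord j y.1 * coord k y.1 * y.2 (p, i, j, k) := by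
    rw [Fintype.sum_prod_type]
    rw [Finset.sum_eq_single p (fun q _ hq => by simp [hq.symm]) (by simp)]
    simp only [Fintype.sum_prod_type, if_true]
    simp only [mul_comm]
  rw [← h1]
  have h2 : ∀ m : CubicIndex, (if p = m.1 then
      coord m.2.1 y.1 * coord m.2.2.1 y.1 * coord m.2.2.2 y.1 else 0) =
      ∑ q, quadJac δ p q y.1 * Ξ m q y.1 + ∑ q, B m p q y.1 * quadPart δ q y.1 :=
    fun m => hΞB m p y.1
  simp only [h2, mul_add, Finset.sum_add_distrib, Finset.mul_sum, Finset.sum_mul]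
  congr 1
  · rw [Finset.sum_comm]
    exact Finset.sum_congr rfl fun _ _ => Finset.sum_congr rfl fun _ _ => by ring
  · rw [Finset.sum_comm]
    exact Finset.sum_congr rfl fun _ _ => Finset.sum_congr rfl fun _ _ => by ring

/-- The change of state variables `(x, ρ) ↦ (x + ξ₀, ρ + ξ₁)`. -/
def shift (z : Pt) (ξ : Fin 2 → ℝ) : Pt := ((z.1.1 + ξ 0, z.1.2 + ξ 1), z.2)

/-- The Taylor expansion in the state variables stops at second order, and the second-order term
does not involve the parameter. -/
theorem quadPart_shift (δ : ℝ) (p : Fin 2) (z : Pt) (ξ : Fin 2 → ℝ) :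
    quadPart δ p (shift z ξ) - quadPart δ p z - ∑ q, quadJac δ p q z * ξ q =
      quadPart δ p ((ξ 0, ξ 1), 0) := by
  fin_cases p <;> simp [quadPart, quadJac, shift, Fin.sum_univ_two] <;> ring

theorem coord_shift_sub (i : Fin 3) (z : Pt) (ξ : Fin 2 → ℝ) :
    coord i (shift z ξ) - coord i z = ![ξ 0, ξ 1, 0] i := by
  fin_cases i <;> simp [shift]

theorem vanishesToOrder_quadPart_mk {V : Type*} [NormedAddCommGroup V] [NormedSpace ℝ V]
    {co : Fin 3 → V → ℝ} {p : V} {ξ : Fin 2 → V → ℝ}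
    (hξ : ∀ q, VanishesToOrder co p 2 (ξ q)) (δ : ℝ) (q : Fin 2) :
    VanishesToOrder co p 4 (fun y => quadPart δ q ((ξ 0 y, ξ 1 y), 0)) := by
  fin_cases q
  · refine ((((hξ 1).mul (hξ 1)).const_mul 2).add (((hξ 0).mul (hξ 0)).const_mul δ)).congr
      (Eventually.of_forall fun y => ?_)
    simp [quadPart]
    ring
  · refine (((hξ 0).mul (hξ 1)).const_mul (-δ)).congr (Eventually.of_forall fun y => ?_)
    simp [quadPart]
    ring

/-- The endomorphism of the plane with the given matrix. -/
noncomputable def ofMatrix (s : Fin 2 → Fin 2 → ℝ) : (ℝ × ℝ) →L[ℝ] (ℝ × ℝ) :=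
  s 0 0 • (ContinuousLinearMap.inl ℝ ℝ ℝ).comp (ContinuousLinearMap.fst ℝ ℝ ℝ) +
    s 0 1 • (ContinuousLinearMap.inl ℝ ℝ ℝ).comp (ContinuousLinearMap.snd ℝ ℝ ℝ) +
    s 1 0 • (ContinuousLinearMap.inr ℝ ℝ ℝ).comp (ContinuousLinearMap.fst ℝ ℝ ℝ) +
    s 1 1 • (ContinuousLinearMap.inr ℝ ℝ ℝ).comp (ContinuousLinearMap.snd ℝ ℝ ℝ)

theorem IsSmoothNear.ofMatrix {V : Type*} [NormedAddCommGroup V] [NormedSpace ℝ V] {p : V}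
    {s : Fin 2 → Fin 2 → V → ℝ} (hs : ∀ i j, IsSmoothNear (s i j) p) :
    IsSmoothNear (fun v => ofMatrix fun i j => s i j v) p :=
  ((((hs 0 0).smul (isSmoothNear_const _)).add ((hs 0 1).smul (isSmoothNear_const _))).add
    ((hs 1 0).smul (isSmoothNear_const _))).add ((hs 1 1).smul (isSmoothNear_const _))

theorem contactEquivalent_of_quadPart {δ : ℝ}
    (hT : ∀ (q : Fin 2) (i j k : Fin 3), InQuadTangent δ fun p z =>
      if p = q then coord i z * coord j z * coord k z else 0)
    {F G : Pt → ℝ × ℝ}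
    (hF : ∀ p, VanishesToOrder coord 0 3 (fun z => comps (F z) p - quadPart δ p z))
    (hG : ∀ p, VanishesToOrder coord 0 3 (fun z => comps (G z) p - quadPart δ p z)) :
    ContactEquivalent F G := by
  have hE : ∀ p, VanishesToOrder coord 0 3 (fun z => comps (G z) p - comps (F z) p) := fun p =>
    ((hG p).sub (hF p)).congr (Eventually.of_forall fun z => by ring)
  choose e he heE using fun p => (hE p).exists_cubic (n := 0)
  -- The value forced at `z = 0`, where the equation for `c` reads `c + e(0) = 0`.
  set c₀ : CubicIndex → ℝ := fun m => -e m.1 m.2.1 m.2.2.1 m.2.2.2 0 with hc₀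
  obtain ⟨ξ, b, hξ, hb, hid⟩ := exists_combination hT c₀
  let Y := Pt × (CubicIndex → ℝ)
  let co : Fin 3 → Y → ℝ := fun i y => coord i y.1
  have hfst : IsSmoothNear (fun y : Y => y.1) ((0 : Pt), c₀) := contDiff_fst.isSmoothNear _
  have hco : ∀ i, IsSmoothNear (co i) ((0 : Pt), c₀) := fun i => (isSmoothNear_coord i _).comp hfst
  have hco0 : ∀ i, co i ((0 : Pt), c₀) = 0 := coord_origin
  have hself : ∀ i, VanishesToOrder co ((0 : Pt), c₀) 1 (co i) := VanishesToOrder.coord_self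
  have hξs : ∀ q, IsSmoothNear (ξ q) ((0 : Pt), c₀) := fun q => (hξ q).isSmoothNear hco
  have hbs : ∀ p q, IsSmoothNear (b p q) ((0 : Pt), c₀) := fun p q => (hb p q).isSmoothNear hco
  have hξ0 : ∀ q, ξ q ((0 : Pt), c₀) = 0 := fun q => (hξ q).apply_eq_zero hco0
  have hb0 : ∀ p q, b p q ((0 : Pt), c₀) = 0 := fun p q => (hb p q).apply_eq_zero hco0
  let w : Y → Pt := fun y => shift y.1 fun q => ξ q y
  have hws : IsSmoothNear w ((0 : Pt), c₀) :=
    (((hco 0).add (hξs 0)).prodMk ((hco 1).add (hξs 1))).prodMk (hco 2)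
  have hw0 : w ((0 : Pt), c₀) = 0 := by
    simp [w, shift, hξ0]
  have hwd : ∀ i, VanishesToOrder co ((0 : Pt), c₀) 2 (fun y => coord i (w y) - coord i y.1) := by
    intro i
    simp only [w, coord_shift_sub]
    fin_cases i
    · exact hξ 0
    · exact hξ 1
    · exact VanishesToOrder.zero 2
  have hw1 : ∀ i, VanishesToOrder co ((0 : Pt), c₀) 1 (fun y => coord i (w y)) := fun i =>
    (((hwd i).of_succ hco).add (hself i)).congr
      (Eventually.of_forall fun y => (sub_add_cancel _ _).symm)
  have hdiff : ∀ {n : ℕ} {g : Pt → ℝ}, VanishesToOrder coord 0 n g →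
      VanishesToOrder co ((0 : Pt), c₀) (n + 1) (fun y => g (w y) - g y.1) := fun hg =>
    hg.comp_sub_comp hws hfst hw0 rfl hw1 hself hwd
  -- Everything in `S·G(X) - F` beyond `dQ·ξ + b·Q + (G - F)`. Each term has order 4, as `ξ` has
  -- order 2, `b` order 1, `G - Q` order 3, and substituting `w` raises the order of a difference by
  -- one.
  let rem : Fin 2 → Y → ℝ := fun p y =>
    quadPart δ p ((ξ 0 y, ξ 1 y), 0) +
    ((comps (G (w y)) p - quadPart δ p (w y)) - (comps (G y.1) p - quadPart δ p y.1)) +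
    ∑ q, b p q y * (quadPart δ q (w y) - quadPart δ q y.1) +
    ∑ q, b p q y * (comps (G (w y)) q - quadPart δ q (w y))
  have hrem : ∀ p, VanishesToOrder co ((0 : Pt), c₀) (1 + 3) (rem p) := by
    intro p
    refine ((VanishesToOrder.add ?_ ?_).add (VanishesToOrder.sum fun q _ => ?_)).add
      (VanishesToOrder.sum fun q _ => ?_)
    · exact vanishesToOrder_quadPart_mk hξ δ p
    · exact hdiff (hG p)
    · exact (hb p q).mul (hdiff (vanishesToOrder_quadPart δ q))
    · exact (hb p q).mul ((hG q).comp hws hw0 hw1)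
  -- The spare order in `1 + 3` stays in the coefficients: `r` vanishes at `z = 0` for every `c`
  -- near `c₀`, as the implicit function theorem requires.
  choose r hr hrE using fun p => (hrem p).exists_cubic
  let Ψ : Y → CubicIndex → ℝ := fun y m =>
    e m.1 m.2.1 m.2.2.1 m.2.2.2 y.1 + r m.1 m.2.1 m.2.2.1 m.2.2.2 y
  have hΨ : IsSmoothNear Ψ ((0 : Pt), c₀) := IsSmoothNear.pi fun m =>
    (IsSmoothNear.comp_of_eq (he _ _ _ _) hfst rfl).add ((hr _ _ _ _).isSmoothNear hco)
  have hΨ0 : ∀ᶠ c in 𝓝 c₀, Ψ ((0 : Pt), c) = -c₀ := by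
    have hr0 : ∀ m : CubicIndex, ∀ᶠ c in 𝓝 c₀,
        r m.1 m.2.1 m.2.2.1 m.2.2.2 ((0 : Pt), c) = 0 := by
      intro m
      obtain ⟨a, -, ea⟩ := hr m.1 m.2.1 m.2.2.1 m.2.2.2
      have ht : Tendsto (fun c => ((0 : Pt), c)) (𝓝 c₀) (𝓝 ((0 : Pt), c₀)) :=
        Continuous.tendsto (by fun_prop) _
      filter_upwards [ht.eventually ea] with c h
      rw [h]
      simp [co, coord_origin]
    filter_upwards [Filter.eventually_all.2 hr0] with c h
    funext m
    simp [Ψ, h m, hc₀]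
  obtain ⟨c, hc, hc0, hcΨ⟩ := exists_isSmoothNear_implicit hΨ hΨ0
  have hgr : IsSmoothNear (fun z : Pt => (z, c z)) 0 := (contDiff_id.isSmoothNear _).prodMk hc
  have hgr0 : ((0 : Pt), c 0) = ((0 : Pt), c₀) := by rw [hc0]
  have hgrt : Tendsto (fun z : Pt => (z, c z)) (𝓝 0) (𝓝 ((0 : Pt), c₀)) := by
    rw [← hgr0]; exact hgr.continuousAt.tendsto
  have hξz : ∀ q, VanishesToOrder coord 0 2 (fun z => ξ q (z, c z)) := fun q =>
    (hξ q).comp hgr hgr0 fun i => VanishesToOrder.coord_self i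
  have hξzs : ∀ q, IsSmoothNear (fun z => ξ q (z, c z)) 0 := fun q =>
    (hξs q).comp_of_eq hgr hgr0
  have hcs : ∀ i, IsSmoothNear (coord i) 0 := fun i => isSmoothNear_coord i 0
  refine ⟨fun z => ofMatrix fun p q => (if p = q then 1 else 0) + b p q (z, c z),
    fun z => (z.1.1 + ξ 0 (z, c z), z.1.2 + ξ 1 (z, c z)), id, ?_, ?_,
    contDiff_id.isSmoothNear _, ?_, rfl, ?_, ?_, ?_, ?_⟩
  · exact IsSmoothNear.ofMatrix fun p q =>
      (isSmoothNear_const _).add ((hbs p q).comp_of_eq hgr hgr0)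
  · exact ((hcs 0).add (hξzs 0)).prodMk ((hcs 1).add (hξzs 1))
  · simp [hgr0, hξ0]
  · simp
  · have : (ofMatrix fun p q => (if p = q then 1 else 0) + b p q ((0 : Pt), c 0)) =
        ContinuousLinearMap.id ℝ (ℝ × ℝ) := by
      ext <;> simp [ofMatrix, hgr0, hb0]
    beta_reduce
    rw [this, ContinuousLinearMap.det]
    simp
  · have hι : HasFDerivAt (fun u : ℝ × ℝ => ((u, 0) : Pt)) (ContinuousLinearMap.inl ℝ (ℝ × ℝ) ℝ)
        0 := hasFDerivAt_prodMk_left 0 0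
    have hz : ∀ q, HasFDerivAt (fun u : ℝ × ℝ => ξ q (((u, 0) : Pt), c (u, 0)))
        (0 : (ℝ × ℝ) →L[ℝ] ℝ) 0 := by
      intro q
      have h := (hξz q).hasFDerivAt_zero hcs coord_origin
      have := HasFDerivAt.comp (g := fun z => ξ q (z, c z)) (f := fun u : ℝ × ℝ => ((u, 0) : Pt))
        0 h hι
      rwa [ContinuousLinearMap.zero_comp] at this
    have hX := (hasFDerivAt_fst.add (hz 0)).prodMk (hasFDerivAt_snd.add (hz 1))
    have hid : (ContinuousLinearMap.fst ℝ ℝ ℝ + 0).prod (ContinuousLinearMap.snd ℝ ℝ ℝ + 0) =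
        ContinuousLinearMap.id ℝ (ℝ × ℝ) := by
      ext <;> simp
    rw [hid] at hX
    have hX' : HasFDerivAt (fun u : ℝ × ℝ => (u.1 + ξ 0 (((u, 0) : Pt), c (u, 0)),
        u.2 + ξ 1 (((u, 0) : Pt), c (u, 0)))) (ContinuousLinearMap.id ℝ (ℝ × ℝ)) 0 := hX
    rw [hX'.fderiv, ContinuousLinearMap.det]
    simp
  · have hall := Filter.eventually_all.2 hrE
    filter_upwards [hcΨ, hgrt.eventually hall, Filter.eventually_all.2 heE] with z h1 h2 h3
    have key : ∀ p, comps (G (w (z, c z))) p + ∑ q, b p q (z, c z) * comps (G (w (z, c z))) q -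
        comps (F z) p = 0 := by
      intro p
      have e1 : comps (G (w (z, c z))) p + ∑ q, b p q (z, c z) * comps (G (w (z, c z))) q -
          comps (F z) p = (∑ q, quadJac δ p q z * ξ q (z, c z) +
            ∑ q, b p q (z, c z) * quadPart δ q z) + (comps (G z) p - comps (F z) p) +
            rem p (z, c z) := by
        have := quadPart_shift δ p z fun q => ξ q (z, c z)
        simp only [rem, ← this, Fin.sum_univ_two, w]
        ring
      rw [e1, hid p (z, c z), h3 p, h2 p]
      simp only [← Finset.sum_add_distrib, ← mul_add]
      refine Finset.sum_eq_zero fun i _ => Finset.sum_eq_zero fun j _ =>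
        Finset.sum_eq_zero fun k _ => ?_
      have h4 := congrFun h1 (p, i, j, k)
      simp only [Ψ, Pi.add_apply, Pi.zero_apply, ← add_assoc] at h4
      rw [← mul_add, h4, mul_zero]
    have k0 := key 0
    have k1 := key 1
    simp only [comps, Fin.sum_univ_two, Matrix.cons_val, w, shift] at k0 k1
    refine Prod.ext ?_ ?_
    · simp [ofMatrix]
      linear_combination -k0
    · simp [ofMatrix]
      linear_combination -k1

end Determinacy

/-! ### From 2-jets to the quadratic part and its Jacobian. -/

section Jets

theorem SameJet.vanishesToOrder_sub {k : ℕ} {F G : Pt → ℝ × ℝ} (h : SameJet k F G)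
    (hF : IsSmoothNear F 0) (hG : IsSmoothNear G 0) (p : Fin 2) :
    VanishesToOrder coord 0 (k + 1) (fun z => comps (F z) p - comps (G z) p) := by
  obtain ⟨L, hL⟩ : ∃ L : ℝ × ℝ →L[ℝ] ℝ, ∀ w, L w = comps w p := by
    fin_cases p
    · exact ⟨ContinuousLinearMap.fst ℝ ℝ ℝ, fun w => rfl⟩
    · exact ⟨ContinuousLinearMap.snd ℝ ℝ ℝ, fun w => rfl⟩
  refine vanishesToOrder_of_iteratedFDeriv_eq_zero ((hF.comps p).sub (hG.comps p)) fun i hi => ?_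
  have hle : (i : ℕ∞ω) ≤ ∞ := by exact_mod_cast le_top
  have hc : ∀ {H : Pt → ℝ × ℝ}, IsSmoothNear H 0 →
      iteratedFDeriv ℝ i (fun z => comps (H z) p) 0 =
        L.compContinuousMultilinearMap (iteratedFDeriv ℝ i H 0) := by
    intro H hH
    have := L.iteratedFDeriv_comp_left hH.contDiffAt hle
    rw [← this]
    congr 1
    funext z
    exact (hL _).symm
  have hsub := iteratedFDeriv_sub_apply (𝕜 := ℝ) (i := i)
    ((hF.comps p).contDiffAt.of_le hle) ((hG.comps p).contDiffAt.of_le hle)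
  refine hsub.trans ?_
  rw [hc hF, hc hG, h i hi, sub_self]

/-- With `s = t + 2`, the terms in `β` are multiples of `x³` and `x²ρ`. -/
theorem vanishesToOrder_normalForm_sub (δ β : ℝ) {s : ℕ} (hs : 1 < s) (p : Fin 2) :
    VanishesToOrder coord 0 3 (fun z : Pt => comps
      (z.2 * z.1.1 + 2 * z.1.2 ^ 2 + δ * z.1.1 ^ 2 + β * z.1.1 ^ (s + 1),
        z.2 * z.1.2 / 2 - δ * z.1.1 * z.1.2 + β * z.1.1 ^ s * z.1.2 / 2) p - quadPart δ p z) := by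
  obtain ⟨t, rfl⟩ : ∃ t, s = t + 2 := ⟨s - 2, by omega⟩
  have hx : ∀ c : ℝ, IsSmoothNear (fun z : Pt => c * z.1.1 ^ t) 0 := fun c =>
    ContDiff.isSmoothNear (by fun_prop) 0
  have hm : ∀ i j k, VanishesToOrder coord 0 3 (fun z => coord i z * (coord j z * coord k z)) :=
    fun i j k => (vanishesToOrder_coord_mul_coord j k).coord_mul i
  fin_cases p
  · refine ((hm 0 0 0).smooth_mul (hx β)).congr (Eventually.of_forall fun z => ?_)
    simp [comps, quadPart]
    ring
  · refine ((hm 0 0 1).smooth_mul (hx (β / 2))).congr (Eventually.of_forall fun z => ?_)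
    simp [comps, quadPart]
    ring

theorem vanishesToOrder_sub_quadPart {δ β : ℝ} {s : ℕ} (hs : 1 < s)
    {F : Pt → ℝ × ℝ} (hF : IsSmoothNear F 0)
    (hjet : SameJet 2 F fun z : Pt =>
      (z.2 * z.1.1 + 2 * z.1.2 ^ 2 + δ * z.1.1 ^ 2 + β * z.1.1 ^ (s + 1),
        z.2 * z.1.2 / 2 - δ * z.1.1 * z.1.2 + β * z.1.1 ^ s * z.1.2 / 2)) (p : Fin 2) :
    VanishesToOrder coord 0 3 (fun z => comps (F z) p - quadPart δ p z) := by
  have hP : IsSmoothNear (fun z : Pt =>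
      ((z.2 * z.1.1 + 2 * z.1.2 ^ 2 + δ * z.1.1 ^ 2 + β * z.1.1 ^ (s + 1),
        z.2 * z.1.2 / 2 - δ * z.1.1 * z.1.2 + β * z.1.1 ^ s * z.1.2 / 2) : ℝ × ℝ)) 0 :=
    ContDiff.isSmoothNear (by fun_prop) 0
  refine ((hjet.vanishesToOrder_sub hF hP p).add
    (vanishesToOrder_normalForm_sub δ β hs p)).congr (Eventually.of_forall fun z => ?_)
  ring

theorem fderiv_quadPart (δ : ℝ) (p q : Fin 2) (z : Pt) :
    fderiv ℝ (quadPart δ p) z (basisVec q.castSucc) = quadJac δ p q z := by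
  have hx : HasFDerivAt (fun z : Pt => z.1.1) ((ContinuousLinearMap.fst ℝ ℝ ℝ).comp
    (ContinuousLinearMap.fst ℝ (ℝ × ℝ) ℝ)) z := hasFDerivAt_fst.comp z hasFDerivAt_fst
  have hρ : HasFDerivAt (fun z : Pt => z.1.2) ((ContinuousLinearMap.snd ℝ ℝ ℝ).comp
    (ContinuousLinearMap.fst ℝ (ℝ × ℝ) ℝ)) z := hasFDerivAt_snd.comp z hasFDerivAt_fst
  have hl : HasFDerivAt (fun z : Pt => z.2) (ContinuousLinearMap.snd ℝ (ℝ × ℝ) ℝ) z :=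
    hasFDerivAt_snd
  fin_cases p
  · have h := ((hl.mul hx).add ((hρ.pow 2).const_mul 2)).add ((hx.pow 2).const_mul δ)
    have h' : HasFDerivAt (quadPart δ 0) _ z := h
    simp only [Fin.zero_eta]
    rw [h'.fderiv]
    fin_cases q <;> simp [basisVec, quadJac] <;> ring
  · have h := ((hl.mul hρ).mul_const (1 / 2 : ℝ)).sub ((hx.mul hρ).const_mul δ)
    have h' : HasFDerivAt (quadPart δ 1) _ z := h.congr_of_eventuallyEq
      (Eventually.of_forall fun z => by simp [quadPart]; ring)
    simp only [Fin.mk_one]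
    rw [h'.fderiv]
    fin_cases q <;> simp [basisVec, quadJac]
    ring

theorem vanishesToOrder_fderiv_sub_quadJac {δ : ℝ} {f : Pt → ℝ} {p : Fin 2}
    (hf : IsSmoothNear f 0)
    (h : VanishesToOrder coord 0 3 (fun z => f z - quadPart δ p z)) (q : Fin 2) :
    VanishesToOrder coord 0 2
      (fun z => fderiv ℝ f z (basisVec q.castSucc) - quadJac δ p q z) := by
  refine (h.fderiv_apply (fun i => isSmoothNear_coord i 0) (basisVec q.castSucc)).congr ?_
  have hq := (vanishesToOrder_quadPart δ p).isSmoothNear fun i => isSmoothNear_coord i 0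
  have hq' : Differentiable ℝ (quadPart δ p) := by
    fin_cases p
    · show Differentiable ℝ fun z : Pt => z.2 * z.1.1 + 2 * z.1.2 ^ 2 + δ * z.1.1 ^ 2
      fun_prop
    · show Differentiable ℝ fun z : Pt => z.2 * z.1.2 / 2 - δ * z.1.1 * z.1.2
      fun_prop
  filter_upwards [hf] with z h1
  rw [fderiv_fun_sub (h1.differentiableAt (by simp)) (hq' z), ← fderiv_quadPart]
  rfl

end Jets

/-! ### The ring of smooth germs and its maximal ideal. -/

section Germs

theorem toGerm_congr {f g : Pt → ℝ} {hf : IsSmoothNear f 0} {hg : IsSmoothNear g 0}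
    (h : f =ᶠ[𝓝 0] g) : toGerm f hf = toGerm g hg :=
  Subtype.ext (Germ.coe_eq.2 h)

/-- The germs of the coordinate functions. -/
noncomputable def coordGerm (i : Fin 3) : SmoothGerm := toGerm (coord i) (isSmoothNear_coord i 0)

theorem maxIdeal_eq_span_range : maxIdeal = Ideal.span (Set.range coordGerm) := by
  rw [maxIdeal]
  congr 1
  ext g
  simp only [Set.mem_insert_iff, Set.mem_singleton_iff, Set.mem_range, Fin.exists_fin_succ,
    eq_comm (b := g)]
  simp
  rfl

theorem coordGerm_mem (i : Fin 3) : coordGerm i ∈ maxIdeal := by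
  rw [maxIdeal_eq_span_range]
  exact Ideal.subset_span ⟨i, rfl⟩

theorem VanishesToOrder.toGerm_mem {n : ℕ} {f : Pt → ℝ} (hf : VanishesToOrder coord 0 n f)
    (hs : IsSmoothNear f 0) : toGerm f hs ∈ maxIdeal ^ n := by
  induction n generalizing f with
  | zero => simp
  | succ n ih =>
    obtain ⟨a, ha, ea⟩ := hf
    have has := fun i => (ha i).isSmoothNear fun i => isSmoothNear_coord i 0
    have hc := fun i => isSmoothNear_coord i 0
    have e : toGerm f hs = coordGerm 0 * toGerm (a 0) (has 0) +
        coordGerm 1 * toGerm (a 1) (has 1) + coordGerm 2 * toGerm (a 2) (has 2) := by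
      refine (toGerm_congr (hg := (((hc 0).mul (has 0)).add ((hc 1).mul (has 1))).add
        ((hc 2).mul (has 2))) ?_).trans rfl
      filter_upwards [ea] with z h
      rw [h, Fin.sum_univ_three]
    rw [e, pow_succ']
    have hm : ∀ i, coordGerm i * toGerm (a i) (has i) ∈ maxIdeal * maxIdeal ^ n := fun i =>
      Ideal.mul_mem_mul (coordGerm_mem i) (ih (ha i) (has i))
    exact add_mem (add_mem (hm 0) (hm 1)) (hm 2)

/-- The value at the origin, as a ring homomorphism. -/
noncomputable def evalHom : SmoothGerm →+* ℝ := Germ.valueRingHom.comp SmoothGerm.subtype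

theorem isUnit_of_evalHom_ne_zero {g : SmoothGerm} (hg : evalHom g ≠ 0) : IsUnit g := by
  obtain ⟨g, f, hf, rfl⟩ := g
  have hf0 : f 0 ≠ 0 := hg
  have hne : ∀ᶠ z in 𝓝 0, f z ≠ 0 := hf.continuousAt.eventually_ne hf0
  have hi : IsSmoothNear (fun z => (f z)⁻¹) 0 := by
    filter_upwards [hf, hne] with z h1 h2 using h1.inv h2
  refine IsUnit.of_mul_eq_one (toGerm _ hi) ?_
  have e : toGerm (fun z => f z * (f z)⁻¹) (hf.mul hi) =
      toGerm (fun _ => 1) (isSmoothNear_const 1) := toGerm_congr <| by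
    filter_upwards [hne] with z h using mul_inv_cancel₀ h
  exact e

/-- A germ with nonzero value at the origin is a unit, and `x * y + 1` has value 1 there when `x`
lies in the ideal. This is the locality that Nakayama's lemma needs. -/
theorem maxIdeal_le_jacobson : maxIdeal ≤ Ideal.jacobson ⊥ := by
  have hker : maxIdeal ≤ RingHom.ker evalHom := by
    rw [maxIdeal_eq_span_range, Ideal.span_le]
    rintro _ ⟨i, rfl⟩
    exact coord_origin i
  intro x hx
  rw [Ideal.mem_jacobson_bot]
  intro y
  apply isUnit_of_evalHom_ne_zero
  have : evalHom x = 0 := hker hx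
  simp [this]

end Germs

/-! ### The restricted tangent space, by Nakayama's lemma. -/

section RestrictedTangent

/-- The standard basis of the free module of pairs of germs. -/
noncomputable def stdVec : Fin 2 → SmoothGerm × SmoothGerm := ![(1, 0), (0, 1)]

/-- The cubic monomial pairs. -/
noncomputable def cubicVec (m : CubicIndex) : SmoothGerm × SmoothGerm :=
  (coordGerm m.2.1 * coordGerm m.2.2.1 * coordGerm m.2.2.2) • stdVec m.1

theorem maxIdealVec_three_le_span :
    maxIdealVec 3 ≤ Submodule.span SmoothGerm (Set.range cubicVec) := by
  have key : ∀ q, ∀ r ∈ maxIdeal ^ 3,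
      r • stdVec q ∈ Submodule.span SmoothGerm (Set.range cubicVec) := by
    intro q r hr
    have hle : maxIdeal ^ 3 ≤ (Submodule.span SmoothGerm (Set.range cubicVec)).comap
        (LinearMap.toSpanSingleton SmoothGerm _ (stdVec q)) := by
      rw [pow_three', maxIdeal_eq_span_range, Ideal.span_mul_span', Ideal.span_mul_span',
        Ideal.span, Submodule.span_le]
      rintro _ ⟨_, ⟨_, ⟨i, rfl⟩, _, ⟨j, rfl⟩, rfl⟩, _, ⟨k, rfl⟩, rfl⟩
      exact Submodule.subset_span ⟨(q, i, j, k), rfl⟩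
    exact hle hr
  refine Submodule.smul_le.2 fun r hr n hn => ?_
  induction hn using Submodule.span_induction with
  | mem x hx =>
    rcases hx with rfl | rfl
    · exact key 0 r hr
    · exact key 1 r hr
  | zero => simp
  | add x y _ _ hx hy => rw [smul_add]; exact add_mem hx hy
  | smul a x _ hx => rw [smul_comm]; exact Submodule.smul_mem _ _ hx

theorem mk_mem_maxIdealVec {n : ℕ} {f g : SmoothGerm} (hf : f ∈ maxIdeal ^ n)
    (hg : g ∈ maxIdeal ^ n) : (f, g) ∈ maxIdealVec n := by
  have e : (f, g) = f • ((1, 0) : SmoothGerm × SmoothGerm) + g • (0, 1) := by simp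
  rw [e]
  exact add_mem (Submodule.smul_mem_smul hf (Submodule.subset_span (by simp)))
    (Submodule.smul_mem_smul hg (Submodule.subset_span (by simp)))

/-- Passing from `Q` to `F` in the tangent combination leaves products of order 2 + 2 (`ξ` with the
Jacobian error) and 1 + 3 (`b` with `Q - F`), all in `𝓜⁴`. -/
theorem mem_restrictedTangent_sup {δ : ℝ} {F : Pt → ℝ × ℝ} (hF : IsSmoothNear F 0)
    (hQ : ∀ p, VanishesToOrder coord 0 3 (fun z => comps (F z) p - quadPart δ p z))
    {h : Fin 2 → Pt → ℝ} (hh : InQuadTangent δ h) (hs : ∀ p, IsSmoothNear (h p) 0) :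
    (toGerm (h 0) (hs 0), toGerm (h 1) (hs 1)) ∈ restrictedTangent F hF ⊔ maxIdealVec 4 := by
  obtain ⟨ξ, b, hξ, hb, hhe⟩ := hh
  have hc := fun i => isSmoothNear_coord i 0
  have hξs := fun q => (hξ q).isSmoothNear hc
  have hbs := fun p q => (hb p q).isSmoothNear hc
  have hJ := fun p q => vanishesToOrder_fderiv_sub_quadJac (hF.comps p) (hQ p) q
  let rem : Fin 2 → Pt → ℝ := fun p z =>
    ξ 0 z * (quadJac δ p 0 z - fderiv ℝ (fun w => comps (F w) p) z (basisVec 0)) +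
    ξ 1 z * (quadJac δ p 1 z - fderiv ℝ (fun w => comps (F w) p) z (basisVec 1)) +
    b p 0 z * (quadPart δ 0 z - comps (F z) 0) + b p 1 z * (quadPart δ 1 z - comps (F z) 1)
  have hrem : ∀ p, VanishesToOrder coord 0 4 (rem p) := by
    intro p
    have h1 : ∀ q, VanishesToOrder coord 0 4 (fun z => ξ q z * (quadJac δ p q z -
        fderiv ℝ (fun w => comps (F w) p) z (basisVec q.castSucc))) := fun q =>
      ((hξ q).mul ((hJ p q).const_mul (-1))).congr (Eventually.of_forall fun z => by ring)
    have h2 : ∀ q, VanishesToOrder coord 0 4 (fun z => b p q z *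
        (quadPart δ q z - comps (F z) q)) := fun q =>
      ((hb p q).mul ((hQ q).const_mul (-1))).congr (Eventually.of_forall fun z => by ring)
    exact (((h1 0).add (h1 1)).add (h2 0)).add (h2 1)
  have hrs := fun p => (hrem p).isSmoothNear hc
  have hid : ∀ p, h p = fun z =>
      ξ 0 z * fderiv ℝ (fun w => comps (F w) p) z (basisVec 0) +
      ξ 1 z * fderiv ℝ (fun w => comps (F w) p) z (basisVec 1) +
      b p 0 z * comps (F z) 0 + b p 1 z * comps (F z) 1 + rem p z := by
    intro p
    funext z
    rw [hhe p z]
    simp only [rem, Fin.sum_univ_two]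
    ring
  let X : Fin 2 → SmoothGerm := fun q => toGerm (ξ q) (hξs q)
  let B : Fin 2 → Fin 2 → SmoothGerm := fun p q => toGerm (b p q) (hbs p q)
  have e : (toGerm (h 0) (hs 0), toGerm (h 1) (hs 1)) =
      ((X 0 • dirD F hF ((1, 0), 0) + X 1 • dirD F hF ((0, 1), 0)) +
      (B 0 0 • (comp₁ F hF, (0 : SmoothGerm)) + B 0 1 • (comp₂ F hF, (0 : SmoothGerm)) +
        B 1 0 • ((0 : SmoothGerm), comp₁ F hF) + B 1 1 • ((0 : SmoothGerm), comp₂ F hF))) +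
      (toGerm (rem 0) (hrs 0), toGerm (rem 1) (hrs 1)) := by
    have e0 : toGerm (h 0) (hs 0) = X 0 * (dirD F hF ((1, 0), 0)).1 +
        X 1 * (dirD F hF ((0, 1), 0)).1 + B 0 0 * comp₁ F hF + B 0 1 * comp₂ F hF +
        toGerm (rem 0) (hrs 0) :=
      Subtype.ext (congrArg (fun f : Pt → ℝ => (f : (𝓝 (0 : Pt)).Germ ℝ)) (hid 0))
    have e1 : toGerm (h 1) (hs 1) = X 0 * (dirD F hF ((1, 0), 0)).2 +
        X 1 * (dirD F hF ((0, 1), 0)).2 + B 1 0 * comp₁ F hF + B 1 1 * comp₂ F hF +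
        toGerm (rem 1) (hrs 1) :=
      Subtype.ext (congrArg (fun f : Pt → ℝ => (f : (𝓝 (0 : Pt)).Germ ℝ)) (hid 1))
    rw [e0, e1]
    refine Prod.ext ?_ ?_ <;> simp <;> ring
  rw [e]
  refine Submodule.add_mem_sup (Submodule.add_mem_sup ?_ ?_)
    (mk_mem_maxIdealVec ((hrem 0).toGerm_mem _) ((hrem 1).toGerm_mem _))
  · exact add_mem
      (Submodule.smul_mem_smul ((hξ 0).toGerm_mem _) (Submodule.subset_span (by simp)))
      (Submodule.smul_mem_smul ((hξ 1).toGerm_mem _) (Submodule.subset_span (by simp)))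
  · have hB : ∀ p q, B p q ∈ maxIdeal := fun p q => by
      simpa using (hb p q).toGerm_mem (hbs p q)
    exact add_mem (add_mem (add_mem
      (Submodule.smul_mem_smul (hB 0 0) (Submodule.subset_span (by simp)))
      (Submodule.smul_mem_smul (hB 0 1) (Submodule.subset_span (by simp))))
      (Submodule.smul_mem_smul (hB 1 0) (Submodule.subset_span (by simp))))
      (Submodule.smul_mem_smul (hB 1 1) (Submodule.subset_span (by simp)))

theorem maxIdealVec_three_le_restrictedTangent {δ : ℝ}
    (hT : ∀ (q : Fin 2) (i j k : Fin 3), InQuadTangent δ fun p z =>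
      if p = q then coord i z * coord j z * coord k z else 0)
    {F : Pt → ℝ × ℝ} (hF : IsSmoothNear F 0)
    (hQ : ∀ p, VanishesToOrder coord 0 3 (fun z => comps (F z) p - quadPart δ p z)) :
    maxIdealVec 3 ≤ restrictedTangent F hF := by
  -- Nakayama applies to the span of the cubic monomial pairs, which is finitely generated by
  -- construction; `𝓜⁴` pairs lie in `𝓜` times that span.
  refine maxIdealVec_three_le_span.trans (Submodule.le_of_le_smul_of_le_jacobson_bot
    (Submodule.fg_span (Set.finite_range _)) maxIdeal_le_jacobson ?_)
  have h4 : maxIdealVec 4 ≤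
      maxIdeal • Submodule.span SmoothGerm (Set.range cubicVec) := by
    have : maxIdealVec 4 = maxIdeal • maxIdealVec 3 := by
      rw [maxIdealVec, maxIdealVec, pow_succ' _ 3, Submodule.mul_smul]
    rw [this]
    exact Submodule.smul_mono le_rfl maxIdealVec_three_le_span
  rw [Submodule.span_le]
  rintro _ ⟨⟨q, i, j, k⟩, rfl⟩
  have hc := fun i => isSmoothNear_coord i 0
  have hm : IsSmoothNear (fun z => coord i z * coord j z * coord k z) 0 :=
    ((hc i).mul (hc j)).mul (hc k)
  have hs : ∀ p, IsSmoothNear (fun z =>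
      if p = q then coord i z * coord j z * coord k z else 0) 0 := fun p => by
    split_ifs
    · exact hm
    · exact isSmoothNear_const 0
  refine sup_le_sup_left h4 _ ?_
  convert mem_restrictedTangent_sup hF hQ (hT q i j k) hs using 1
  fin_cases q
  · refine Prod.ext ?_ ?_
    · exact mul_one _
    · exact mul_zero _
  · refine Prod.ext ?_ ?_
    · exact mul_zero _
    · exact mul_one _

end RestrictedTangent

end BifurcationGerm

theorem mainTheorem5 (δ β : ℝ) (hδ : δ = 1 ∨ δ = -1) (s : ℕ) (hs : 1 < s)
    (F : BifurcationGerm.Pt → ℝ × ℝ) (hF : BifurcationGerm.IsSmoothNear F 0)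
    (hjet : BifurcationGerm.SameJet 2 F fun ((x, ρ), lam) =>
      (lam * x + 2 * ρ ^ 2 + δ * x ^ 2 + β * x ^ (s + 1),
        lam * ρ / 2 - δ * x * ρ + β * x ^ s * ρ / 2)) :
    BifurcationGerm.IsDetermined 2 F ∧
      BifurcationGerm.maxIdealVec 3 ≤ BifurcationGerm.restrictedTangent F hF := by
  have hT := BifurcationGerm.inQuadTangent_coord_mul hδ
  have hQ := BifurcationGerm.vanishesToOrder_sub_quadPart hs hF hjet
  refine ⟨fun G hG hFG => BifurcationGerm.contactEquivalent_of_quadPart hT hQ fun p => ?_,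
    BifurcationGerm.maxIdealVec_three_le_restrictedTangent hT hF hQ⟩
  -- Equal 2-jets give `G` the same quadratic part as `F`.
  exact ((hQ p).sub (hFG.vanishesToOrder_sub hF hG p)).congr
    (Eventually.of_forall fun z => by ring)
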